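/- \textbf{Theorem (provable convergence of blind calibration to the exact solution).} \emph{Model.} Let $A_1,\dots,A_p\in\mathbb R^{m\times n}$ ($m,p\ge 1$) be random matrices all of whose $mp$ rows $a_{i,l}^\top$ are independent copies of a centred, isotropic ($\mathbb E\,aa^\top=I_n$) sub-Gaussian random vector with $\sup_{\|u\|_2=1}\sup_{q\ge1}q^{-1/2}(\mathbb E|\langle a,u\rangle|^q)^{1/q}\le K$. Let $x\in\mathbb R^n\setminus\{0\}$, let $d\in\mathbb R^m$ have positive entries, and let $y_l=\operatorname{diag}(d)A_lx$. Put $x^\star=\frac{\|d\|_1}{m}x$, $d^\star=\frac{m}{\|d\|_1}d$, and $$f(\xi,\gamma)=\tfrac1{2mp}\sum_{l=1}^p\|\operatorname{diag}(\gamma)A_l\xi-y_l\|_2^2,\qquad \Delta(\xi,\gamma)=\|\xi-x^\star\|_2^2+\tfrac{\|x^\star\|_2^2}{m}\|\gamma-d^\star\|_2^2,$$ $\mathcal C_\rho=\{\mathbf 1_m+v:\ \mathbf 1_m^\top v=0,\ \|v\|_\infty\le\rho\}$ and $\mathcal D_{\kappa,\rho}=\{(\xi,\gamma)\in\mathbb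 R^n\times\mathcal C_\rho:\Delta(\xi,\gamma)\le\kappa^2\|x^\star\|_2^2\}$. Assume $d^\star\in\mathcal C_\rho$. The point $(x^\star,d^\star)$ is a global minimiser of $f$ over $\mathbb R^n\times\{\gamma\in\mathbb R^m:\gamma\ge0,\ \mathbf 1_m^\top\gamma=m\}$. \emph{Algorithm.} With fixed steps $\mu_\xi,\mu_\gamma$, projected gradient descent is $\xi_0=\frac1{mp}\sum_lA_l^\top y_l$, $\gamma_0=\mathbf 1_m$, $$\xi_{k+1}=\xi_k-\mu_\xi\nabla_\xi f(\xi_k,\gamma_k),\qquad \gamma_{k+1}=P_{\mathcal C_\rho}\big(\gamma_k-\mu_\gamma(I_m-\tfrac1m\mathbf 1_m\mathbf 1_m^\top)\nabla_\gamma f(\xi_k,\gamma_k)\big),$$ where $P_{\mathcal C_\rho}$ is the Euclidean projection on $\mathcal C_\rho$. \emph{Claim.} For every $K>0$ there are constants $C,c,C_0>0$ depending only on $K$ such that the following holds. Let $\delta\in(0,1)$, $t\ge1$, $0\le\rho<\frac{1-2\delta}{9}$, and $$n\ge C_0\,t\log(mp),\qquad p\ge C_0\,\delta^{-2}\log m,\qquad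 \sqrt m\,p\ge C_0\,\delta^{-2}(n+m)\log\tfrac n\delta .$$ Let $\kappa=\sqrt{\delta^2+\rho^2}$, $\eta=2(1-9\rho-2\delta)$, $L=4\sqrt2\,[1+\rho+(1+\kappa)\|x^\star\|_2]$ and $\tau=\min\{1,\|x^\star\|_2^2/m\}$. Then, with probability exceeding $$1-C\big[me^{-c\delta^2p}+e^{-c\delta^2\sqrt m\,p}+e^{-c\delta^2mp}+(mp)^{-t}\big],$$ for every $\mu\in(0,\tau\eta/L^2)$ the iterates with steps $\mu_\xi=\mu$, $\mu_\gamma=\mu\,m/\|x^\star\|_2^2$ satisfy, for all $k\ge0$, $$(\xi_k,\gamma_k)\in\mathcal D_{\kappa,\rho},\qquad \Delta(\xi_k,\gamma_k)\le\big(1-\eta\mu+\tfrac{L^2}{\tau}\mu^2\big)^k(\delta^2+\rho^2)\|x^\star\|_2^2,$$ where $0<1-\eta\mu+\frac{L^2}{\tau}\mu^2<1$. Hence $\Delta(\xi_k,\gamma_k)\to0$ and $(\xi_k,\gamma_k)\to(x^\star,d^\star)$ as $k\to\infty$. -/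

import Mathlib

open MeasureTheory ProbabilityTheory Filter Topology

noncomputable section

namespace BlindCal

/-- `ℝ^n` with the Euclidean norm. -/
abbrev Vec (n : ℕ) : Type := EuclideanSpace ℝ (Fin n)

/-! ### Sub-Gaussian random vectors and the sensing model -/

/-- The sub-Gaussian norm `sup_{q ≥ 1} q^{-1/2} (E |X|^q)^{1/q}` of a real random variable. -/
def psi2Norm {Ω : Type*} [MeasurableSpace Ω] (P : Measure Ω) (X : Ω → ℝ) : ENNReal :=
  ⨆ (q : ℝ) (_ : 1 ≤ q), eLpNorm X (ENNReal.ofReal q) P / ENNReal.ofReal (Real.sqrt q)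

/-- The sub-Gaussian norm of a random vector: the supremum of the sub-Gaussian norms of its
one-dimensional marginals `⟨a, u⟩` over all unit vectors `u`. -/
def psi2NormVec {Ω : Type*} [MeasurableSpace Ω] {n : ℕ} (P : Measure Ω) (a : Ω → Vec n) :
    ENNReal :=
  ⨆ (u : Vec n) (_ : ‖u‖ = 1), psi2Norm P (fun w => inner ℝ (a w) u)

/-- The `i`-th row of a matrix, as a vector of `ℝ^n`. -/
def rowVec {m n : ℕ} (M : Matrix (Fin m) (Fin n) ℝ) (i : Fin m) : Vec n :=
  WithLp.toLp 2 (M i)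

/-- The random sensing model: the rows `a_{i,l}` of the random matrices `A_1, …, A_p` are
independent and identically distributed, centred, isotropic (`E a aᵀ = I`) and sub-Gaussian,
with sub-Gaussian norm at most `K`. -/
structure IsSensingModel {Ω : Type*} [MeasurableSpace Ω] (P : Measure Ω) {n m p : ℕ}
    (A : Fin p → Ω → Matrix (Fin m) (Fin n) ℝ) (K : ℝ) : Prop where
  measurable : ∀ i l, Measurable (fun w => rowVec (A l w) i)
  indep : iIndepFun (fun (il : Fin m × Fin p) (w : Ω) => rowVec (A il.2 w) il.1) P
  identDistrib : ∀ i l i' l',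
    IdentDistrib (fun w => rowVec (A l w) i) (fun w => rowVec (A l' w) i') P P
  centred : ∀ i l, ∫ w, rowVec (A l w) i ∂P = 0
  isotropic : ∀ i l (j k : Fin n),
    ∫ w, rowVec (A l w) i j * rowVec (A l w) i k ∂P = if j = k then 1 else 0
  subGaussian : ∀ i l, psi2NormVec P (fun w => rowVec (A l w) i) ≤ ENNReal.ofReal K

/-! ### The blind calibration problem -/

/-- The vector `diag(g) M v`. -/
def gainApply {n m : ℕ} (g : Vec m) (M : Matrix (Fin m) (Fin n) ℝ) (v : Vec n) : Vec m :=
  WithLp.toLp 2 (Matrix.mulVec (Matrix.diagonal g.ofLp) (Matrix.mulVec M v.ofLp))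

/-- The snapshots `y_l = diag(d) A_l x`. -/
def snapshots {n m p : ℕ} (A : Fin p → Matrix (Fin m) (Fin n) ℝ) (x : Vec n) (d : Vec m) :
    Fin p → Vec m :=
  fun l => gainApply d (A l) x

/-- The objective `f(ξ, γ) = (2mp)⁻¹ ∑_l ‖diag(γ) A_l ξ - y_l‖²`. -/
def objective {n m p : ℕ} (A : Fin p → Matrix (Fin m) (Fin n) ℝ) (y : Fin p → Vec m)
    (ξ : Vec n) (γ : Vec m) : ℝ :=
  1 / (2 * (m : ℝ) * (p : ℝ)) * ∑ l, ‖gainApply γ (A l) ξ - y l‖ ^ 2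

/-- The all-ones vector of `ℝ^m`. -/
def ones (m : ℕ) : Vec m := WithLp.toLp 2 (fun _ => (1 : ℝ))

/-- The scaled probability simplex `{γ ≥ 0 : ∑ γ_i = m}`. -/
def simplex (m : ℕ) : Set (Vec m) := {γ | (∀ i, 0 ≤ γ i) ∧ ∑ i, γ i = (m : ℝ)}

/-- `𝟏 + (𝟏^⊥ ∩ ρ B_∞)`. -/
def gainSet (m : ℕ) (ρ : ℝ) : Set (Vec m) :=
  {γ | ∃ v : Vec m, ∑ i, v i = 0 ∧ (∀ i, |v i| ≤ ρ) ∧ γ = ones m + v}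

/-- `‖d‖₁`. -/
def l1Norm {m : ℕ} (d : Vec m) : ℝ := ∑ i, |d i|

/-- `x⋆ = (‖d‖₁ / m) x`. -/
def xStar {n m : ℕ} (x : Vec n) (d : Vec m) : Vec n := (l1Norm d / (m : ℝ)) • x

/-- `d⋆ = (m / ‖d‖₁) d`. -/
def dStar {m : ℕ} (d : Vec m) : Vec m := ((m : ℝ) / l1Norm d) • d

/-- `Δ(ξ, γ) = ‖ξ - x⋆‖² + (‖x⋆‖² / m) ‖γ - d⋆‖²`. -/
def dist2 {n m : ℕ} (xs : Vec n) (ds : Vec m) (ξ : Vec n) (γ : Vec m) : ℝ :=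
  ‖ξ - xs‖ ^ 2 + ‖xs‖ ^ 2 / (m : ℝ) * ‖γ - ds‖ ^ 2

/-- The neighbourhood `D_{κ,ρ}` of `(x⋆, d⋆)`. -/
def nbhdD {n m : ℕ} (xs : Vec n) (ds : Vec m) (κ ρ : ℝ) : Set (Vec n × Vec m) :=
  {z | z.2 ∈ gainSet m ρ ∧ dist2 xs ds z.1 z.2 ≤ κ ^ 2 * ‖xs‖ ^ 2}

/-! ### Projected gradient descent -/

/-- `∇_ξ f(ξ, γ)`. -/
def gradSignal {n m p : ℕ} (A : Fin p → Matrix (Fin m) (Fin n) ℝ) (y : Fin p → Vec m)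
    (ξ : Vec n) (γ : Vec m) : Vec n :=
  gradient (fun ξ' => objective A y ξ' γ) ξ

/-- `∇_γ f(ξ, γ)`. -/
def gradGain {n m p : ℕ} (A : Fin p → Matrix (Fin m) (Fin n) ℝ) (y : Fin p → Vec m)
    (ξ : Vec n) (γ : Vec m) : Vec m :=
  gradient (fun γ' => objective A y ξ γ') γ

/-- The projection `(I - m⁻¹ 𝟏 𝟏ᵀ) v` of `v` on `𝟏^⊥`. -/
def projOnesPerp {m : ℕ} (v : Vec m) : Vec m := v - ((∑ i, v i) / (m : ℝ)) • ones m

/-- The projected gain gradient `∇^⊥_γ f(ξ, γ)`. -/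
def projGradGain {n m p : ℕ} (A : Fin p → Matrix (Fin m) (Fin n) ℝ) (y : Fin p → Vec m)
    (ξ : Vec n) (γ : Vec m) : Vec m :=
  projOnesPerp (gradGain A y ξ γ)

theorem exists_nearest_gainSet (m : ℕ) {ρ : ℝ} (hρ : 0 ≤ ρ) (v : Vec m) :
    ∃ z ∈ gainSet m ρ, ∀ z' ∈ gainSet m ρ, ‖v - z‖ ≤ ‖v - z'‖ := by
  have hset : gainSet m ρ =
      {γ : Vec m | ∑ i, (γ i - 1) = 0} ∩ ⋂ i, {γ : Vec m | |γ i - 1| ≤ ρ} := by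
    ext γ
    simp only [gainSet, Set.mem_ofPred_eq, Set.mem_inter_iff, Set.mem_iInter]
    constructor
    · rintro ⟨v, h1, h2, rfl⟩
      simpa [ones] using ⟨h1, h2⟩
    · rintro ⟨h1, h2⟩
      exact ⟨γ - ones m, by simpa [ones] using h1, by simpa [ones] using h2, by simp⟩
  have hclosed : IsClosed (gainSet m ρ) := by
    rw [hset]
    refine IsClosed.inter (isClosed_eq (by fun_prop) continuous_const) ?_
    exact isClosed_iInter fun i => isClosed_le (by fun_prop) continuous_const
  have hne : (gainSet m ρ).Nonempty := ⟨ones m, 0, by simp, by simpa using fun _ => hρ, by simp⟩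
  obtain ⟨z, hz, h⟩ := hclosed.exists_infDist_eq_dist hne v
  refine ⟨z, hz, fun z' hz' => ?_⟩
  rw [← dist_eq_norm, ← dist_eq_norm, ← h]
  exact Metric.infDist_le_dist_of_mem hz'

/-- The projector on the convex set `gainSet m ρ`: the nearest point, which exists for `ρ ≥ 0`
(for `ρ < 0`, which is never used, the value is arbitrary). -/
def projGainSet {m : ℕ} (ρ : ℝ) (v : Vec m) : Vec m :=
  if h : 0 ≤ ρ then (exists_nearest_gainSet m h v).choose else v

/-- The initial point `ξ_0 = (mp)⁻¹ ∑_l A_lᵀ y_l`. -/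
def initSignal {n m p : ℕ} (A : Fin p → Matrix (Fin m) (Fin n) ℝ) (y : Fin p → Vec m) : Vec n :=
  (1 / ((m : ℝ) * (p : ℝ))) • ∑ l, WithLp.toLp 2 (Matrix.mulVec (A l).transpose (y l).ofLp)

/-- The iterates `(ξ_k, γ_k)` of projected gradient descent with fixed steps `μξ`, `μγ`. -/
def pgd {n m p : ℕ} (A : Fin p → Matrix (Fin m) (Fin n) ℝ) (y : Fin p → Vec m)
    (ρ μξ μγ : ℝ) : ℕ → Vec n × Vec m
  | 0 => (initSignal A y, ones m)
  | k + 1 =>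
    let z := pgd A y ρ μξ μγ k
    (z.1 - μξ • gradSignal A y z.1 z.2,
      projGainSet ρ (z.2 - μγ • projGradGain A y z.1 z.2))

/-! ### The constants -/

/-- `κ = √(δ² + ρ²)`. -/
def kappa (δ ρ : ℝ) : ℝ := Real.sqrt (δ ^ 2 + ρ ^ 2)

/-- `η = 2 (1 - 9ρ - 2δ)`. -/
def eta (δ ρ : ℝ) : ℝ := 2 * (1 - 9 * ρ - 2 * δ)

/-- `L = 4√2 [1 + ρ + (1 + κ) ‖x⋆‖]`. -/
def lipL {n : ℕ} (xs : Vec n) (δ ρ : ℝ) : ℝ :=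
  4 * Real.sqrt 2 * (1 + ρ + (1 + kappa δ ρ) * ‖xs‖)

/-- `τ = min {1, ‖x⋆‖² / m}`. -/
def tau {n : ℕ} (m : ℕ) (xs : Vec n) : ℝ := min 1 (‖xs‖ ^ 2 / (m : ℝ))

end BlindCal

end

noncomputable section

namespace BlindCal

/-! The proof has a deterministic and a probabilistic half, joined by `GoodSensing`: three deviation
bounds for the sensing matrices at the fixed signal x⋆.

Deterministic half. For a row a, put u = ⟨a, ξ - x⋆⟩, v = ⟨a, x⋆⟩ and let e be the entry of γ - d⋆;
the residual is γu + ev. Both gains sum to m, so γ - d⋆ is orthogonal to the ones vector, and the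
dangerous average of e u v loses its mean and is of order δ. Hence, in the metric Δ, the gradient
has inner product at least (η/2)Δ with the error (`GoodSensing.regularity`) and squared dual norm at
most (L²/τ)Δ (`GoodSensing.curvature`). The gain step μm/‖x⋆‖² is the step μ measured in this
metric, and projecting does not increase the distance to d⋆, so expanding the square gives the
factor 1 - ημ + L²μ²/τ (`GoodSensing.dist2_step_le`). Convexity of f is not needed, since only
comparisons with the solution occur. The start is close because ξ₀ has mean x⋆.

Probabilistic half. Every deviation is a weighted sum of independent centred products of two
sub-Gaussian marginals, which are sub-exponential. Bernstein's inequality (`measure_le_abs_sum_le`),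
1/2-nets and a union bound yield `GoodSensing` (`IsSensingModel.exists_goodSensing`). The weights of
the gain deviation are as large as 1/(√m p), which is where the sample size √m p comes from. -/

/-! ### Gradients, data and the global minimiser -/

/-- In each variable separately the objective is a sum of squares of affine forms, so this serves
both partial gradients. Pairing with a test vector is the only form in which gradients are used
later. -/
theorem inner_gradient_sum_sq {E ι : Type*} [NormedAddCommGroup E] [InnerProductSpace ℝ E]
    [CompleteSpace E] [Fintype ι] (c : ℝ) (φ : ι → E →L[ℝ] ℝ) (b : ι → ℝ) (x w : E) :
    inner ℝ (gradient (fun z => c * ∑ j, (φ j z - b j) ^ 2) x) w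
      = 2 * c * ∑ j, (φ j x - b j) * φ j w := by
  have h : HasFDerivAt (fun z => c * ∑ j, (φ j z - b j) ^ 2)
      (c • ∑ j, (2 * (φ j x - b j)) • φ j) x := by
    refine HasFDerivAt.const_mul (HasFDerivAt.fun_sum fun j _ => ?_) c
    have := ((φ j).hasFDerivAt (x := x)).sub_const (b j) |>.pow 2
    simpa using this
  rw [gradient, h.fderiv, InnerProductSpace.toDual_symm_apply]
  simp only [sum_apply, smul_apply, smul_eq_mul, Finset.mul_sum]
  refine Finset.sum_congr rfl fun j _ => by ring

theorem gainApply_apply {n m : ℕ} (g : Vec m) (M : Matrix (Fin m) (Fin n) ℝ) (v : Vec n)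
    (i : Fin m) : gainApply g M v i = g i * inner ℝ (rowVec M i) v := by
  have : inner ℝ (rowVec M i) v = M.mulVec v.ofLp i := by
    simp [rowVec, Matrix.mulVec, dotProduct, PiLp.inner_apply, mul_comm]
  rw [this, gainApply]
  exact Matrix.mulVec_diagonal g.ofLp _ i

theorem objective_eq {n m p : ℕ} (A : Fin p → Matrix (Fin m) (Fin n) ℝ) (y : Fin p → Vec m)
    (ξ : Vec n) (γ : Vec m) :
    objective A y ξ γ = 1 / (2 * (m : ℝ) * (p : ℝ)) * ∑ j : Fin m × Fin p,
      (γ j.1 * inner ℝ (rowVec (A j.2) j.1) ξ - y j.2 j.1) ^ 2 := by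
  simp only [objective, EuclideanSpace.norm_sq_eq, Fintype.sum_prod_type_right]
  simp [gainApply_apply]

theorem inner_gradSignal {n m p : ℕ} (A : Fin p → Matrix (Fin m) (Fin n) ℝ) (y : Fin p → Vec m)
    (ξ w : Vec n) (γ : Vec m) :
    inner ℝ (gradSignal A y ξ γ) w = 1 / ((m : ℝ) * p) * ∑ j : Fin m × Fin p,
      (γ j.1 * inner ℝ (rowVec (A j.2) j.1) ξ - y j.2 j.1) *
        (γ j.1 * inner ℝ (rowVec (A j.2) j.1) w) := by
  have := inner_gradient_sum_sq (1 / (2 * (m : ℝ) * (p : ℝ)))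
    (fun j : Fin m × Fin p => γ j.1 • innerSL ℝ (rowVec (A j.2) j.1)) (fun j => y j.2 j.1) ξ w
  simp only [smul_apply, innerSL_apply_apply, smul_eq_mul] at this
  simp only [gradSignal, objective_eq]
  rw [this]
  congr 1
  by_cases hm : (m : ℝ) = 0
  · simp [hm]
  by_cases hp : (p : ℝ) = 0
  · simp [hp]
  field_simp

theorem inner_gradGain {n m p : ℕ} (A : Fin p → Matrix (Fin m) (Fin n) ℝ) (y : Fin p → Vec m)
    (ξ : Vec n) (γ g : Vec m) :
    inner ℝ (gradGain A y ξ γ) g = 1 / ((m : ℝ) * p) * ∑ j : Fin m × Fin p,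
      (γ j.1 * inner ℝ (rowVec (A j.2) j.1) ξ - y j.2 j.1) *
        (g j.1 * inner ℝ (rowVec (A j.2) j.1) ξ) := by
  have := inner_gradient_sum_sq (1 / (2 * (m : ℝ) * (p : ℝ)))
    (fun j : Fin m × Fin p => (inner ℝ (rowVec (A j.2) j.1) ξ) •
      (EuclideanSpace.proj j.1 : Vec m →L[ℝ] ℝ)) (fun j => y j.2 j.1) γ g
  simp only [smul_apply, PiLp.proj_apply, smul_eq_mul] at this
  simp only [gradGain, objective_eq]
  simp only [mul_comm (inner ℝ (rowVec _ _) ξ)] at this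
  rw [this]
  congr 1
  by_cases hm : (m : ℝ) = 0
  · simp [hm]
  by_cases hp : (p : ℝ) = 0
  · simp [hp]
  field_simp

theorem inner_initSignal {n m p : ℕ} (A : Fin p → Matrix (Fin m) (Fin n) ℝ) (y : Fin p → Vec m)
    (w : Vec n) :
    inner ℝ (initSignal A y) w = 1 / ((m : ℝ) * p) * ∑ j : Fin m × Fin p,
      y j.2 j.1 * inner ℝ (rowVec (A j.2) j.1) w := by
  simp only [initSignal, real_inner_smul_left, sum_inner, Fintype.sum_prod_type_right]
  congr 1
  refine Finset.sum_congr rfl fun l _ => ?_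
  simp only [PiLp.inner_apply, rowVec, Matrix.mulVec, dotProduct, Matrix.transpose_apply,
    Finset.mul_sum, RCLike.inner_apply, conj_trivial]
  rw [Finset.sum_comm]
  refine Finset.sum_congr rfl fun j _ => Finset.sum_congr rfl fun k _ => by ring

theorem l1Norm_eq_sum {m : ℕ} {d : Vec m} (hd : ∀ i, 0 < d i) : l1Norm d = ∑ i, d i :=
  Finset.sum_congr rfl fun i _ => abs_of_pos (hd i)

theorem l1Norm_pos {m : ℕ} (hm : 0 < m) {d : Vec m} (hd : ∀ i, 0 < d i) : 0 < l1Norm d := by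
  have : Nonempty (Fin m) := ⟨⟨0, hm⟩⟩
  rw [l1Norm_eq_sum hd]
  exact Finset.sum_pos (fun i _ => hd i) Finset.univ_nonempty

/-- The scalings of x and d cancel, so the normalised pair produces the same data; the convergence
argument sees only this pair. -/
theorem snapshots_apply {n m p : ℕ} (hm : 0 < m) {d : Vec m} (hd : ∀ i, 0 < d i)
    (A : Fin p → Matrix (Fin m) (Fin n) ℝ) (x : Vec n) (l : Fin p) (i : Fin m) :
    snapshots A x d l i = dStar d i * inner ℝ (rowVec (A l) i) (xStar x d) := by
  have h1 : (m : ℝ) ≠ 0 := by positivity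
  have h2 := (l1Norm_pos hm hd).ne'
  simp only [snapshots, gainApply_apply, dStar, xStar, inner_smul_right, PiLp.smul_apply,
    smul_eq_mul]
  field_simp

theorem dStar_mem_simplex {m : ℕ} (hm : 0 < m) {d : Vec m} (hd : ∀ i, 0 < d i) :
    dStar d ∈ simplex m := by
  have h2 := l1Norm_pos hm hd
  refine ⟨fun i => ?_, ?_⟩
  · have := hd i
    simp only [dStar, PiLp.smul_apply, smul_eq_mul]
    positivity
  · simp only [dStar, PiLp.smul_apply, smul_eq_mul, ← Finset.mul_sum, ← l1Norm_eq_sum hd]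
    field_simp

theorem objective_star_le {n m p : ℕ} (hm : 0 < m) {d : Vec m} (hd : ∀ i, 0 < d i)
    (A : Fin p → Matrix (Fin m) (Fin n) ℝ) (x ξ : Vec n) (γ : Vec m) :
    objective A (snapshots A x d) (xStar x d) (dStar d)
      ≤ objective A (snapshots A x d) ξ γ := by
  have h : objective A (snapshots A x d) (xStar x d) (dStar d) = 0 := by
    simp [objective_eq, snapshots_apply hm hd]
  rw [h, objective]
  positivity

/-! ### Geometry of the gain set and its projections -/

theorem mem_gainSet {m : ℕ} {ρ : ℝ} {γ : Vec m} :
    γ ∈ gainSet m ρ ↔ ∑ i, γ i = m ∧ ∀ i, |γ i - 1| ≤ ρ := by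
  constructor
  · rintro ⟨v, h1, h2, rfl⟩
    simpa [ones, Finset.sum_add_distrib] using ⟨h1, h2⟩
  · rintro ⟨h1, h2⟩
    exact ⟨γ - ones m, by simp [ones, h1], by simpa [ones] using h2, by simp⟩

theorem convex_gainSet (m : ℕ) (ρ : ℝ) : Convex ℝ (gainSet m ρ) := by
  intro γ hγ γ' hγ' a b ha hb hab
  rw [mem_gainSet] at *
  refine ⟨?_, fun i => ?_⟩
  · simp only [PiLp.add_apply, PiLp.smul_apply, smul_eq_mul, Finset.sum_add_distrib,
      ← Finset.mul_sum, hγ.1, hγ'.1]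
    rw [← add_mul, hab, one_mul]
  · have h1 := abs_le.1 (hγ.2 i)
    have h2 := abs_le.1 (hγ'.2 i)
    simp only [PiLp.add_apply, PiLp.smul_apply, smul_eq_mul]
    obtain rfl : b = 1 - a := by linarith
    rw [abs_le]
    constructor <;> nlinarith

theorem projGainSet_mem {m : ℕ} {ρ : ℝ} (hρ : 0 ≤ ρ) (v : Vec m) :
    projGainSet ρ v ∈ gainSet m ρ := by
  rw [projGainSet, dif_pos hρ]
  exact (exists_nearest_gainSet m hρ v).choose_spec.1

/-- The nearest point u of a convex set satisfies ⟨v - u, z - u⟩ ≤ 0 for z in the set; expanding ‖v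
- z‖² around u then gives the bound. -/
theorem norm_projGainSet_sub_le {m : ℕ} {ρ : ℝ} (hρ : 0 ≤ ρ) (v : Vec m) {z : Vec m}
    (hz : z ∈ gainSet m ρ) : ‖projGainSet ρ v - z‖ ≤ ‖v - z‖ := by
  have hmem := projGainSet_mem hρ v
  have hmin : ∀ z' ∈ gainSet m ρ, ‖v - projGainSet ρ v‖ ≤ ‖v - z'‖ := by
    rw [projGainSet, dif_pos hρ]
    exact (exists_nearest_gainSet m hρ v).choose_spec.2
  set u := projGainSet ρ v
  have hinf : ‖v - u‖ = ⨅ w : gainSet m ρ, ‖v - w‖ := by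
    have : Nonempty (gainSet m ρ) := ⟨⟨u, hmem⟩⟩
    refine le_antisymm (le_ciInf fun w => hmin w w.2) ?_
    exact ciInf_le ⟨0, by rintro _ ⟨w, rfl⟩; positivity⟩ (⟨u, hmem⟩ : gainSet m ρ)
  have h := (norm_eq_iInf_iff_real_inner_le_zero (convex_gainSet m ρ) hmem).1 hinf z hz
  have h2 : ‖v - z‖ ^ 2 = ‖v - u‖ ^ 2 - 2 * inner ℝ (v - u) (z - u) + ‖z - u‖ ^ 2 := by
    rw [← norm_sub_sq_real]; congr 2; abel
  rw [norm_sub_rev u z]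
  refine le_of_sq_le_sq ?_ (norm_nonneg _)
  nlinarith [sq_nonneg ‖v - u‖]

/-- Differences of admissible gains sum to zero, so against them the projected gradient acts as the
full one. -/
theorem inner_projOnesPerp {m : ℕ} (v e : Vec m) (he : ∑ i, e i = 0) :
    inner ℝ (projOnesPerp v) e = inner ℝ v e := by
  have : inner ℝ (ones m) e = 0 := by simp [PiLp.inner_apply, ones, he]
  rw [projOnesPerp, inner_sub_left, real_inner_smul_left, this]; ring

theorem sum_projOnesPerp {m : ℕ} (hm : 0 < m) (v : Vec m) : ∑ i, projOnesPerp v i = 0 := by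
  have h1 : (m : ℝ) ≠ 0 := by positivity
  simp [projOnesPerp, ones]
  field_simp
  ring

theorem norm_projOnesPerp_le {m : ℕ} (hm : 0 < m) (v : Vec m) : ‖projOnesPerp v‖ ≤ ‖v‖ := by
  have h : ‖projOnesPerp v‖ ^ 2 ≤ ‖v‖ * ‖projOnesPerp v‖ := by
    rw [← real_inner_self_eq_norm_sq, inner_projOnesPerp _ _ (sum_projOnesPerp hm v)]
    exact real_inner_le_norm _ _
  rcases (norm_nonneg (projOnesPerp v)).eq_or_lt with h0 | h0
  · rw [← h0]; positivity
  · nlinarith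

/-! ### Deterministic concentration properties -/

/-- The deterministic properties of the sensing matrices that make projected gradient descent
converge: concentration of the row blocks at `xs`, of the empirical covariance, and of the
gain-weighted empirical covariance. -/
structure GoodSensing {n m p : ℕ} (A : Fin p → Matrix (Fin m) (Fin n) ℝ) (xs : Vec n)
    (ε : ℝ) : Prop where
  rows : ∀ i, |1 / (p : ℝ) * ∑ l, inner ℝ (rowVec (A l) i) xs ^ 2 - ‖xs‖ ^ 2| ≤ ε * ‖xs‖ ^ 2
  cov : ∀ h h' : Vec n, |1 / ((m : ℝ) * p) * ∑ j : Fin m × Fin p,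
    inner ℝ (rowVec (A j.2) j.1) h * inner ℝ (rowVec (A j.2) j.1) h' - inner ℝ h h'|
      ≤ ε * (‖h‖ * ‖h'‖)
  gain : ∀ (h : Vec n) (g : Vec m), |1 / (√m * p) * ∑ j : Fin m × Fin p,
    g j.1 * (inner ℝ (rowVec (A j.2) j.1) h * inner ℝ (rowVec (A j.2) j.1) xs - inner ℝ h xs)|
      ≤ ε * (‖h‖ * ‖g‖ * ‖xs‖)

namespace GoodSensing

variable {n m p : ℕ} {A : Fin p → Matrix (Fin m) (Fin n) ℝ} {xs : Vec n} {ε : ℝ}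

theorem cov_self (hA : GoodSensing A xs ε) (h : Vec n) :
    |1 / ((m : ℝ) * p) * ∑ j : Fin m × Fin p, inner ℝ (rowVec (A j.2) j.1) h ^ 2 - ‖h‖ ^ 2|
      ≤ ε * ‖h‖ ^ 2 := by
  simpa only [← pow_two, real_inner_self_eq_norm_sq] using hA.cov h h

/-- The weights depend on the row index only, so the sum is a weighted average of row averages. An
arbitrary g may sit on a single row, hence the need for concentration in each row rather than
overall. -/
theorem gain_sq (hA : GoodSensing A xs ε) (g : Vec m) :
    |1 / ((m : ℝ) * p) * ∑ j : Fin m × Fin p,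
        g j.1 ^ 2 * inner ℝ (rowVec (A j.2) j.1) xs ^ 2 - ‖xs‖ ^ 2 / m * ‖g‖ ^ 2|
      ≤ ε * (‖xs‖ ^ 2 / m * ‖g‖ ^ 2) := by
  have h : 1 / ((m : ℝ) * p) * ∑ j : Fin m × Fin p,
        g j.1 ^ 2 * inner ℝ (rowVec (A j.2) j.1) xs ^ 2 - ‖xs‖ ^ 2 / m * ‖g‖ ^ 2
      = 1 / (m : ℝ) * ∑ i, g i ^ 2 *
        (1 / (p : ℝ) * ∑ l, inner ℝ (rowVec (A l) i) xs ^ 2 - ‖xs‖ ^ 2) := by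
    simp only [Fintype.sum_prod_type, EuclideanSpace.norm_sq_eq g, Real.norm_eq_abs, sq_abs,
      mul_sub, Finset.sum_sub_distrib, Finset.mul_sum]
    congr 1
    · refine Finset.sum_congr rfl fun i _ => Finset.sum_congr rfl fun l _ => ?_
      rw [one_div, one_div, one_div, mul_inv]; ring
    · refine Finset.sum_congr rfl fun i _ => by ring
  rw [h, abs_mul, abs_of_nonneg (by positivity)]
  calc _ ≤ 1 / (m : ℝ) * ∑ i, g i ^ 2 * (ε * ‖xs‖ ^ 2) := by
        gcongr
        refine (Finset.abs_sum_le_sum_abs _ _).trans (Finset.sum_le_sum fun i _ => ?_)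
        rw [abs_mul, abs_of_nonneg (sq_nonneg _)]
        gcongr
        exact hA.rows i
    _ = _ := by
        rw [← Finset.sum_mul, EuclideanSpace.norm_sq_eq g]
        simp only [Real.norm_eq_abs, sq_abs]
        ring

/-- Zero sum of g removes the centring term of `gain`; the extra 1/√m produces the gain weight
appearing in Δ. -/
theorem gain_cross (hA : GoodSensing A xs ε) (h : Vec n) (g : Vec m) (hg : ∑ i, g i = 0) :
    |1 / ((m : ℝ) * p) * ∑ j : Fin m × Fin p,
        g j.1 * (inner ℝ (rowVec (A j.2) j.1) h * inner ℝ (rowVec (A j.2) j.1) xs)|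
      ≤ ε * (‖h‖ * (‖xs‖ / √m * ‖g‖)) := by
  have h0 : ∑ j : Fin m × Fin p, g j.1 * inner ℝ h xs = 0 := by
    rw [← Finset.sum_mul, Fintype.sum_prod_type]
    simp [← Finset.mul_sum, hg]
  have h1 := hA.gain h g
  simp only [mul_sub, Finset.sum_sub_distrib, h0, sub_zero] at h1
  have h2 : 1 / ((m : ℝ) * p) = 1 / √m * (1 / (√m * p)) := by
    rw [one_div_mul_one_div, ← mul_assoc, Real.mul_self_sqrt (Nat.cast_nonneg m)]
  rw [h2, mul_assoc, abs_mul, abs_of_nonneg (by positivity)]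
  calc _ ≤ 1 / √m * (ε * (‖h‖ * ‖g‖ * ‖xs‖)) := by gcongr
    _ = _ := by ring

end GoodSensing

/-! ### Regularity and curvature of the objective -/

/-- The right side is γ(γ + e)u² + (ev)² + (2γ + e)u(ev). The first coefficient is at least 1 - 4ρ.
Writing 2γ + e as 2 plus a term of size at most 4ρ costs another 2ρ, and leaves 2euv untouched
because only its average over the measurements is small. -/
theorem regularity_pointwise {ρ γ e u v : ℝ} (hρ9 : ρ ≤ 1 / 9) (hγ : |γ - 1| ≤ ρ)
    (he : |e| ≤ 2 * ρ) :
    (1 - 6 * ρ) * (u ^ 2 + e ^ 2 * v ^ 2) + 2 * (e * (u * v))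
      ≤ (γ * u + e * v) * (γ * u) + (γ * u + e * v) * (e * (u + v)) := by
  have hρ : 0 ≤ ρ := (abs_nonneg _).trans hγ
  obtain ⟨h1, h2⟩ := abs_le.1 hγ
  obtain ⟨h3, h4⟩ := abs_le.1 he
  have hA : 1 - 4 * ρ ≤ γ * (γ + e) := by nlinarith
  have hB : (2 * (γ - 1) + e) * (u * (e * v)) ≥ -(2 * ρ * (u ^ 2 + (e * v) ^ 2)) := by
    have : |(2 * (γ - 1) + e) * (u * (e * v))| ≤ 4 * ρ * ((u ^ 2 + (e * v) ^ 2) / 2) := by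
      rw [abs_mul]
      refine mul_le_mul ?_ ?_ (abs_nonneg _) (by positivity)
      · rw [abs_le]; constructor <;> linarith
      · rw [abs_le]; constructor <;> nlinarith [sq_nonneg (u + e * v), sq_nonneg (u - e * v)]
    have := (abs_le.1 this).1
    linarith
  nlinarith [mul_le_mul_of_nonneg_right hA (sq_nonneg u), mul_nonneg hρ (sq_nonneg (e * v))]

/-- Regularity: the gradient correlates with the error `(ξ - xs, γ - ds)`. -/
theorem GoodSensing.regularity {n m p : ℕ} {A : Fin p → Matrix (Fin m) (Fin n) ℝ} {xs : Vec n}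
    {ε ρ : ℝ} (hA : GoodSensing A xs ε) (hε : 0 ≤ ε) (hρ : ρ ≤ 1 / 9)
    {y : Fin p → Vec m} {ds γ : Vec m}
    (hy : ∀ l i, y l i = ds i * inner ℝ (rowVec (A l) i) xs) (hds : ds ∈ gainSet m ρ)
    (hγ : γ ∈ gainSet m ρ) (ξ : Vec n) (hρ0 : 0 ≤ ρ) :
    (1 - 6 * ρ - 2 * ε) * dist2 xs ds ξ γ
      ≤ inner ℝ (gradSignal A y ξ γ) (ξ - xs) + inner ℝ (gradGain A y ξ γ) (γ - ds) := by
  rw [mem_gainSet] at hds hγ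
  have he0 : ∑ i, (γ - ds) i = 0 := by simp [hds.1, hγ.1]
  have hM1 := abs_le.1 (hA.cov_self (ξ - xs))
  have hM2 := abs_le.1 (hA.gain_sq (γ - ds))
  have hM3 := abs_le.1 (hA.gain_cross (ξ - xs) (γ - ds) he0)
  have hb : (‖xs‖ / √m * ‖γ - ds‖) ^ 2 = ‖xs‖ ^ 2 / m * ‖γ - ds‖ ^ 2 := by
    rw [mul_pow, div_pow, Real.sq_sqrt (Nat.cast_nonneg m)]
  rw [← hb] at hM2
  rw [inner_gradSignal, inner_gradGain, dist2, ← hb, ← mul_add, ← Finset.sum_add_distrib]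
  have key : 1 / ((m : ℝ) * p) * ∑ j : Fin m × Fin p,
      ((1 - 6 * ρ) * (inner ℝ (rowVec (A j.2) j.1) (ξ - xs) ^ 2
        + (γ - ds) j.1 ^ 2 * inner ℝ (rowVec (A j.2) j.1) xs ^ 2)
      + 2 * ((γ - ds) j.1 * (inner ℝ (rowVec (A j.2) j.1) (ξ - xs)
        * inner ℝ (rowVec (A j.2) j.1) xs))) ≤
      1 / ((m : ℝ) * p) * ∑ j : Fin m × Fin p,
        ((γ j.1 * inner ℝ (rowVec (A j.2) j.1) ξ - y j.2 j.1) *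
          (γ j.1 * inner ℝ (rowVec (A j.2) j.1) (ξ - xs)) +
        (γ j.1 * inner ℝ (rowVec (A j.2) j.1) ξ - y j.2 j.1) *
          ((γ - ds) j.1 * inner ℝ (rowVec (A j.2) j.1) ξ)) := by
    refine mul_le_mul_of_nonneg_left (Finset.sum_le_sum fun j _ => ?_) (by positivity)
    have he : |(γ - ds) j.1| ≤ 2 * ρ := by
      have h1 := abs_le.1 (hds.2 j.1)
      have h2 := abs_le.1 (hγ.2 j.1)
      simp only [PiLp.sub_apply]
      rw [abs_le]; constructor <;> linarith
    refine (regularity_pointwise hρ (hγ.2 j.1) he).trans_eq ?_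
    simp only [hy, inner_sub_right, PiLp.sub_apply]
    ring
  refine le_trans ?_ key
  rw [Finset.sum_add_distrib, ← Finset.mul_sum, ← Finset.mul_sum, Finset.sum_add_distrib]
  set M1 := ∑ j : Fin m × Fin p, inner ℝ (rowVec (A j.2) j.1) (ξ - xs) ^ 2
  set M2 := ∑ j : Fin m × Fin p, (γ - ds) j.1 ^ 2 * inner ℝ (rowVec (A j.2) j.1) xs ^ 2
  set M3 := ∑ j : Fin m × Fin p, (γ - ds) j.1 * (inner ℝ (rowVec (A j.2) j.1) (ξ - xs)
        * inner ℝ (rowVec (A j.2) j.1) xs)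
  set c := 1 / ((m : ℝ) * p)
  set a := ‖ξ - xs‖
  set b := ‖xs‖ / √m * ‖γ - ds‖
  have h1 : (1 - ε) * (a ^ 2 + b ^ 2) ≤ c * (M1 + M2) := by linarith [hM1.1, hM2.1]
  -- The cross term is absorbed by ab ≤ (a² + b²)/2; doubled, it costs one further ε.
  have h2 : c * M3 ≥ -(ε * ((a ^ 2 + b ^ 2) / 2)) := by
    nlinarith [hM3.1, mul_nonneg hε (sq_nonneg (a - b))]
  have h3 : (1 - 6 * ρ) * ((1 - ε) * (a ^ 2 + b ^ 2)) ≤ (1 - 6 * ρ) * (c * (M1 + M2)) :=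
    mul_le_mul_of_nonneg_left h1 (by linarith)
  have h4 : 0 ≤ ε * ρ * (a ^ 2 + b ^ 2) := by positivity
  linarith

/-- The mean squared residual is controlled by the distance to the solution. -/
theorem GoodSensing.residual_sq_le {n m p : ℕ} {A : Fin p → Matrix (Fin m) (Fin n) ℝ}
    {xs : Vec n} {ε ρ : ℝ} (hA : GoodSensing A xs ε)
    {y : Fin p → Vec m} {ds γ : Vec m}
    (hy : ∀ l i, y l i = ds i * inner ℝ (rowVec (A l) i) xs)
    (hγ : γ ∈ gainSet m ρ) (ξ : Vec n) (hρ0 : 0 ≤ ρ) :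
    1 / ((m : ℝ) * p) * ∑ j : Fin m × Fin p,
        (γ j.1 * inner ℝ (rowVec (A j.2) j.1) ξ - y j.2 j.1) ^ 2
      ≤ 2 * (1 + ρ) ^ 2 * (1 + ε) * dist2 xs ds ξ γ := by
  rw [mem_gainSet] at hγ
  have hM1 := abs_le.1 (hA.cov_self (ξ - xs))
  have hM2 := abs_le.1 (hA.gain_sq (γ - ds))
  have key : 1 / ((m : ℝ) * p) * ∑ j : Fin m × Fin p,
        (γ j.1 * inner ℝ (rowVec (A j.2) j.1) ξ - y j.2 j.1) ^ 2 ≤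
      1 / ((m : ℝ) * p) * ∑ j : Fin m × Fin p,
        2 * (1 + ρ) ^ 2 * (inner ℝ (rowVec (A j.2) j.1) (ξ - xs) ^ 2
          + (γ - ds) j.1 ^ 2 * inner ℝ (rowVec (A j.2) j.1) xs ^ 2) := by
    gcongr with j
    have hg := abs_le.1 (hγ.2 j.1)
    rw [hy]
    have hS : inner ℝ (rowVec (A j.2) j.1) ξ = inner ℝ (rowVec (A j.2) j.1) (ξ - xs)
      + inner ℝ (rowVec (A j.2) j.1) xs := by rw [inner_sub_right]; ring
    rw [hS]
    set u : ℝ := inner ℝ (rowVec (A j.2) j.1) (ξ - xs)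
    set v : ℝ := inner ℝ (rowVec (A j.2) j.1) xs
    simp only [PiLp.sub_apply]
    have h1 : γ j.1 * (u + v) - ds j.1 * v = γ j.1 * u + (γ j.1 - ds j.1) * v := by ring
    rw [h1]
    have h2 : γ j.1 ^ 2 ≤ (1 + ρ) ^ 2 := sq_le_sq' (by linarith) (by linarith)
    have h3 : (1 : ℝ) ≤ (1 + ρ) ^ 2 := one_le_pow₀ (by linarith)
    nlinarith [sq_nonneg (γ j.1 * u - (γ j.1 - ds j.1) * v),
      mul_le_mul_of_nonneg_right h2 (sq_nonneg u),
      mul_le_mul_of_nonneg_right h3 (sq_nonneg ((γ j.1 - ds j.1) * v))]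
  refine key.trans ?_
  rw [← Finset.mul_sum, Finset.sum_add_distrib, dist2]
  rw [mul_left_comm, mul_assoc (2 * (1 + ρ) ^ 2)]
  refine mul_le_mul_of_nonneg_left ?_ (by positivity)
  linarith [hM1.2, hM2.2]

/-- Test the gradient against itself: Cauchy–Schwarz gives ‖G‖⁴ ≤ R · B‖G‖², and one factor ‖G‖²
cancels. -/
theorem sq_norm_le_of_inner_le_avg {E ι : Type*} [NormedAddCommGroup E] [InnerProductSpace ℝ E]
    [Fintype ι] {c B R : ℝ} (hc : 0 ≤ c) (hB : 0 ≤ B) (G : E) (r s : ι → ℝ)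
    (h : inner ℝ G G = c * ∑ j, r j * s j)
    (hr : c * ∑ j, r j ^ 2 ≤ R) (hs : c * ∑ j, s j ^ 2 ≤ B * ‖G‖ ^ 2) : ‖G‖ ^ 2 ≤ B * R := by
  rw [real_inner_self_eq_norm_sq] at h
  have hR : 0 ≤ R := le_trans (by positivity) hr
  have h1 : (‖G‖ ^ 2) ^ 2 ≤ R * (B * ‖G‖ ^ 2) := by
    calc (‖G‖ ^ 2) ^ 2 = c ^ 2 * (∑ j, r j * s j) ^ 2 := by rw [h]; ring
      _ ≤ c ^ 2 * ((∑ j, r j ^ 2) * ∑ j, s j ^ 2) := by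
        gcongr; exact Finset.sum_mul_sq_le_sq_mul_sq _ _ _
      _ = (c * ∑ j, r j ^ 2) * (c * ∑ j, s j ^ 2) := by ring
      _ ≤ _ := mul_le_mul hr hs (by positivity) hR
  rcases (sq_nonneg ‖G‖).eq_or_lt with h0 | h0
  · rw [← h0]; positivity
  · nlinarith

section Curvature

variable {n m p : ℕ} {A : Fin p → Matrix (Fin m) (Fin n) ℝ} {xs : Vec n} {ε ρ : ℝ}
  {y : Fin p → Vec m} {ds γ : Vec m}

theorem GoodSensing.gradSignal_sq_le (hA : GoodSensing A xs ε) (hε : 0 ≤ ε)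
    (hy : ∀ l i, y l i = ds i * inner ℝ (rowVec (A l) i) xs)
    (hγ : γ ∈ gainSet m ρ) (ξ : Vec n) (hρ0 : 0 ≤ ρ) :
    ‖gradSignal A y ξ γ‖ ^ 2
      ≤ (1 + ρ) ^ 2 * (1 + ε) * (2 * (1 + ρ) ^ 2 * (1 + ε) * dist2 xs ds ξ γ) := by
  refine sq_norm_le_of_inner_le_avg (c := 1 / ((m : ℝ) * p)) (by positivity) (by positivity) _ _ _
    (inner_gradSignal A y ξ _ γ) (hA.residual_sq_le hy hγ ξ hρ0) ?_
  rw [mem_gainSet] at hγ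
  have hM := abs_le.1 (hA.cov_self (gradSignal A y ξ γ))
  set G := gradSignal A y ξ γ
  calc 1 / ((m : ℝ) * p) * ∑ j : Fin m × Fin p, (γ j.1 * inner ℝ (rowVec (A j.2) j.1) G) ^ 2
      ≤ 1 / ((m : ℝ) * p) * ∑ j : Fin m × Fin p,
        (1 + ρ) ^ 2 * inner ℝ (rowVec (A j.2) j.1) G ^ 2 := by
        refine mul_le_mul_of_nonneg_left (Finset.sum_le_sum fun j _ => ?_) (by positivity)
        have hg := abs_le.1 (hγ.2 j.1)
        rw [mul_pow]
        exact mul_le_mul_of_nonneg_right (sq_le_sq' (by linarith) (by linarith)) (sq_nonneg _)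
    _ = (1 + ρ) ^ 2 * (1 / ((m : ℝ) * p) * ∑ j : Fin m × Fin p,
        inner ℝ (rowVec (A j.2) j.1) G ^ 2) := by rw [← Finset.mul_sum]; ring
    _ ≤ (1 + ρ) ^ 2 * ((1 + ε) * ‖G‖ ^ 2) := by
        refine mul_le_mul_of_nonneg_left ?_ (by positivity)
        linarith [hM.2]
    _ = _ := by ring

theorem GoodSensing.gradGain_sq_le (hA : GoodSensing A xs ε) (hε : 0 ≤ ε)
    (hy : ∀ l i, y l i = ds i * inner ℝ (rowVec (A l) i) xs)
    (hγ : γ ∈ gainSet m ρ) (ξ : Vec n) (hρ0 : 0 ≤ ρ) :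
    ‖gradGain A y ξ γ‖ ^ 2
      ≤ (1 + ε) * ‖ξ‖ ^ 2 * (2 * (1 + ρ) ^ 2 * (1 + ε) * dist2 xs ds ξ γ) := by
  refine sq_norm_le_of_inner_le_avg (c := 1 / ((m : ℝ) * p)) (by positivity) (by positivity) _ _ _
    (inner_gradGain A y ξ γ _) (hA.residual_sq_le hy hγ ξ hρ0) ?_
  have hM := abs_le.1 (hA.cov_self ξ)
  set G := gradGain A y ξ γ
  calc 1 / ((m : ℝ) * p) * ∑ j : Fin m × Fin p, (G j.1 * inner ℝ (rowVec (A j.2) j.1) ξ) ^ 2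
      ≤ 1 / ((m : ℝ) * p) * ∑ j : Fin m × Fin p,
        ‖G‖ ^ 2 * inner ℝ (rowVec (A j.2) j.1) ξ ^ 2 := by
        refine mul_le_mul_of_nonneg_left (Finset.sum_le_sum fun j _ => ?_) (by positivity)
        rw [mul_pow]
        refine mul_le_mul_of_nonneg_right ?_ (sq_nonneg _)
        rw [← sq_abs]
        exact pow_le_pow_left₀ (abs_nonneg _) (PiLp.norm_apply_le G j.1) 2
    _ = ‖G‖ ^ 2 * (1 / ((m : ℝ) * p) * ∑ j : Fin m × Fin p,
        inner ℝ (rowVec (A j.2) j.1) ξ ^ 2) := by rw [← Finset.mul_sum]; ring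
    _ ≤ ‖G‖ ^ 2 * ((1 + ε) * ‖ξ‖ ^ 2) := by
        refine mul_le_mul_of_nonneg_left ?_ (by positivity)
        linarith [hM.2]
    _ = _ := by ring

end Curvature

theorem tau_pos {n m : ℕ} (hm : 0 < m) {xs : Vec n} (hxs : xs ≠ 0) : 0 < tau m xs := by
  have := norm_pos_iff.2 hxs
  rw [tau]
  positivity

/-- Uses τ ≤ 1 for the signal part and mτ ≤ ‖x⋆‖² for the gain part; the cross term of the square in
L² is dropped. -/
theorem le_lipL_sq_div_tau {n m : ℕ} (hm : 0 < m) {xs : Vec n} (hxs : xs ≠ 0) {δ ρ : ℝ}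
    (hρ : 0 ≤ ρ) :
    16 * (1 + ρ) ^ 2 + 16 * (m * (1 + kappa δ ρ) ^ 2) ≤ lipL xs δ ρ ^ 2 / tau m xs := by
  have hX := norm_pos_iff.2 hxs
  have hκ : 0 ≤ kappa δ ρ := Real.sqrt_nonneg _
  have hτ := tau_pos hm hxs
  have h1 : tau m xs ≤ 1 := min_le_left _ _
  have h2 : m * tau m xs ≤ ‖xs‖ ^ 2 := by
    have : tau m xs ≤ ‖xs‖ ^ 2 / m := min_le_right _ _
    have hm' : (0 : ℝ) < m := by positivity
    rw [le_div_iff₀ hm'] at this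
    linarith
  rw [le_div_iff₀ hτ, lipL, mul_pow, mul_pow, Real.sq_sqrt (by norm_num)]
  have h3 := mul_le_mul_of_nonneg_left h1 (sq_nonneg (1 + ρ))
  have h4 := mul_le_mul_of_nonneg_left h2 (sq_nonneg (1 + kappa δ ρ))
  have h5 : 0 ≤ (1 + ρ) * ((1 + kappa δ ρ) * ‖xs‖) := by positivity
  nlinarith [sq_nonneg (1 + ρ), sq_nonneg ((1 + kappa δ ρ) * ‖xs‖)]

/-- Bounded curvature: the gradients are Lipschitz at the solution. -/
theorem GoodSensing.curvature {n m p : ℕ} {A : Fin p → Matrix (Fin m) (Fin n) ℝ} {xs : Vec n}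
    {δ ρ : ℝ} {y : Fin p → Vec m} {ds γ : Vec m} (hm : 0 < m) (hxs : xs ≠ 0)
    (hδ : 0 ≤ δ) (hδ2 : δ ≤ 1 / 2) (hρ0 : 0 ≤ ρ) (hρ : ρ ≤ 1 / 9)
    (hA : GoodSensing A xs (δ / 2))
    (hy : ∀ l i, y l i = ds i * inner ℝ (rowVec (A l) i) xs)
    {ξ : Vec n} (hz : (ξ, γ) ∈ nbhdD xs ds (kappa δ ρ) ρ) :
    ‖gradSignal A y ξ γ‖ ^ 2 + m / ‖xs‖ ^ 2 * ‖gradGain A y ξ γ‖ ^ 2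
      ≤ lipL xs δ ρ ^ 2 / tau m xs * dist2 xs ds ξ γ := by
  have hX := norm_pos_iff.2 hxs
  have hκ : 0 ≤ kappa δ ρ := Real.sqrt_nonneg _
  have hm' : (0 : ℝ) < m := by positivity
  obtain ⟨hγ, hD⟩ := hz
  simp only at hγ hD
  have h0 : 0 ≤ dist2 xs ds ξ γ := by rw [dist2]; positivity
  have h1 := hA.gradSignal_sq_le (by positivity) hy hγ ξ hρ0
  have h2 := hA.gradGain_sq_le (by positivity) hy hγ ξ hρ0
  -- The gain gradient grows with ‖ξ‖; the radius κ of the neighbourhood serves to bound it.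
  have hξ : ‖ξ‖ ^ 2 ≤ ((1 + kappa δ ρ) * ‖xs‖) ^ 2 := by
    have ha : ‖ξ - xs‖ ≤ kappa δ ρ * ‖xs‖ := by
      refine le_of_sq_le_sq ?_ (by positivity)
      rw [mul_pow]
      refine le_trans ?_ hD
      rw [dist2]
      exact le_add_of_nonneg_right (by positivity)
    have hb : ‖ξ‖ ≤ ‖xs‖ + ‖ξ - xs‖ := by simpa using norm_add_le xs (ξ - xs)
    exact pow_le_pow_left₀ (norm_nonneg _) (by linarith) 2
  -- Numerically (10/9)²(5/4)² < 1.93.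
  have hc : (1 + ρ) ^ 2 * (1 + δ / 2) ^ 2 ≤ 2 := by
    have ha : (1 + ρ) ^ 2 ≤ (10 / 9) ^ 2 := pow_le_pow_left₀ (by linarith) (by linarith) 2
    have hb : (1 + δ / 2) ^ 2 ≤ (5 / 4) ^ 2 := pow_le_pow_left₀ (by linarith) (by linarith) 2
    nlinarith [mul_le_mul ha hb (sq_nonneg _) (by positivity)]
  have h3 : ‖gradSignal A y ξ γ‖ ^ 2 ≤ 4 * (1 + ρ) ^ 2 * dist2 xs ds ξ γ := by
    refine h1.trans ?_
    calc _ = 2 * (1 + ρ) ^ 2 * ((1 + ρ) ^ 2 * (1 + δ / 2) ^ 2) * dist2 xs ds ξ γ := by ring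
      _ ≤ 2 * (1 + ρ) ^ 2 * 2 * dist2 xs ds ξ γ := by gcongr
      _ = _ := by ring
  have h4 : m / ‖xs‖ ^ 2 * ‖gradGain A y ξ γ‖ ^ 2
      ≤ 4 * (m * (1 + kappa δ ρ) ^ 2) * dist2 xs ds ξ γ := by
    calc _ ≤ m / ‖xs‖ ^ 2 * ((1 + δ / 2) * ((1 + kappa δ ρ) * ‖xs‖) ^ 2 *
          (2 * (1 + ρ) ^ 2 * (1 + δ / 2) * dist2 xs ds ξ γ)) := by
          refine mul_le_mul_of_nonneg_left (h2.trans ?_) (by positivity)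
          gcongr
      _ = 2 * (m * (1 + kappa δ ρ) ^ 2) * ((1 + ρ) ^ 2 * (1 + δ / 2) ^ 2)
          * dist2 xs ds ξ γ := by field_simp
      _ ≤ 2 * (m * (1 + kappa δ ρ) ^ 2) * 2 * dist2 xs ds ξ γ := by gcongr
      _ = _ := by ring
  have h5 := mul_le_mul_of_nonneg_right (le_lipL_sq_div_tau (δ := δ) hm hxs hρ0) h0
  have h6 : 0 ≤ (1 + ρ) ^ 2 * dist2 xs ds ξ γ := by positivity
  have h7 : 0 ≤ (m * (1 + kappa δ ρ) ^ 2) * dist2 xs ds ξ γ := by positivity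
  linarith

/-! ### Contraction, initialisation and convergence -/

/-- One step of projected gradient descent contracts the distance to the solution. -/
theorem GoodSensing.dist2_step_le {n m p : ℕ} {A : Fin p → Matrix (Fin m) (Fin n) ℝ}
    {xs : Vec n} {δ ρ : ℝ} {y : Fin p → Vec m} {ds γ : Vec m} (hm : 0 < m) (hxs : xs ≠ 0)
    (hδ : 0 ≤ δ) (hδ2 : δ ≤ 1 / 2) (hρ0 : 0 ≤ ρ) (hρ : ρ ≤ 1 / 9)
    (hA : GoodSensing A xs (δ / 2))
    (hy : ∀ l i, y l i = ds i * inner ℝ (rowVec (A l) i) xs) (hds : ds ∈ gainSet m ρ)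
    {ξ : Vec n} (hz : (ξ, γ) ∈ nbhdD xs ds (kappa δ ρ) ρ) {μ : ℝ} (hμ : 0 ≤ μ) :
    dist2 xs ds (ξ - μ • gradSignal A y ξ γ)
        (projGainSet ρ (γ - (μ * (m / ‖xs‖ ^ 2)) • projGradGain A y ξ γ))
      ≤ (1 - eta δ ρ * μ + lipL xs δ ρ ^ 2 / tau m xs * μ ^ 2) * dist2 xs ds ξ γ := by
  have hX := norm_pos_iff.2 hxs
  have hm' : (0 : ℝ) < m := by positivity
  have hγ : γ ∈ gainSet m ρ := hz.1
  have h0 : 0 ≤ dist2 xs ds ξ γ := by rw [dist2]; positivity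
  have hcurv := hA.curvature hm hxs hδ hδ2 hρ0 hρ hy hz
  have hreg := hA.regularity (by positivity) hρ hy hds hγ ξ hρ0
  have he0 : ∑ i, (γ - ds) i = 0 := by
    simp [(mem_gainSet.1 hds).1, (mem_gainSet.1 hγ).1]
  have hproj := norm_projGainSet_sub_le hρ0
    (γ - (μ * (m / ‖xs‖ ^ 2)) • projGradGain A y ξ γ) hds
  have hG := inner_projOnesPerp (gradGain A y ξ γ) (γ - ds) he0
  have hGn := norm_projOnesPerp_le hm (gradGain A y ξ γ)
  rw [projGradGain] at *
  set S := gradSignal A y ξ γ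
  set G := gradGain A y ξ γ
  set Q := projOnesPerp G
  have e1 : ‖ξ - μ • S - xs‖ ^ 2
      = ‖ξ - xs‖ ^ 2 - 2 * μ * inner ℝ S (ξ - xs) + μ ^ 2 * ‖S‖ ^ 2 := by
    rw [show ξ - μ • S - xs = (ξ - xs) - μ • S by abel, norm_sub_sq_real, inner_smul_right,
      norm_smul, mul_pow, Real.norm_eq_abs, sq_abs, real_inner_comm]
    ring
  have e2 : ‖γ - (μ * (m / ‖xs‖ ^ 2)) • Q - ds‖ ^ 2
      = ‖γ - ds‖ ^ 2 - 2 * (μ * (m / ‖xs‖ ^ 2)) * inner ℝ G (γ - ds)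
        + (μ * (m / ‖xs‖ ^ 2)) ^ 2 * ‖Q‖ ^ 2 := by
    rw [show γ - (μ * (m / ‖xs‖ ^ 2)) • Q - ds = (γ - ds) - (μ * (m / ‖xs‖ ^ 2)) • Q by abel,
      norm_sub_sq_real, inner_smul_right, norm_smul, mul_pow, Real.norm_eq_abs, sq_abs,
      real_inner_comm, hG]
    ring
  have h1 := pow_le_pow_left₀ (norm_nonneg _) hproj 2
  have h2 : ‖Q‖ ^ 2 ≤ ‖G‖ ^ 2 := pow_le_pow_left₀ (norm_nonneg _) hGn 2
  -- The weight ‖xs‖²/m and the step factor m/‖xs‖² cancel, so both blocks carry the same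
  -- first-order coefficient 2μ.
  have h3 : ‖xs‖ ^ 2 / m * ‖γ - (μ * (m / ‖xs‖ ^ 2)) • Q - ds‖ ^ 2
      = ‖xs‖ ^ 2 / m * ‖γ - ds‖ ^ 2 - 2 * μ * inner ℝ G (γ - ds)
        + μ ^ 2 * (m / ‖xs‖ ^ 2 * ‖Q‖ ^ 2) := by
    rw [e2]; field_simp
  have h4 : dist2 xs ds (ξ - μ • S) (projGainSet ρ (γ - (μ * (m / ‖xs‖ ^ 2)) • Q))
      ≤ dist2 xs ds ξ γ - 2 * μ * (inner ℝ S (ξ - xs) + inner ℝ G (γ - ds))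
        + μ ^ 2 * (‖S‖ ^ 2 + m / ‖xs‖ ^ 2 * ‖Q‖ ^ 2) := by
    have := mul_le_mul_of_nonneg_left h1 (show 0 ≤ ‖xs‖ ^ 2 / (m : ℝ) by positivity)
    simp only [dist2]
    rw [e1]
    linarith
  have h5 : m / ‖xs‖ ^ 2 * ‖Q‖ ^ 2 ≤ m / ‖xs‖ ^ 2 * ‖G‖ ^ 2 :=
    mul_le_mul_of_nonneg_left h2 (by positivity)
  have h6 := mul_le_mul_of_nonneg_left (hcurv.trans' (add_le_add_right h5 _)) (sq_nonneg μ)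
  have h7 : eta δ ρ * dist2 xs ds ξ γ
      ≤ 2 * (inner ℝ S (ξ - xs) + inner ℝ G (γ - ds)) := by
    have : eta δ ρ ≤ 2 * (1 - 6 * ρ - 2 * (δ / 2)) := by rw [eta]; linarith
    linarith [mul_le_mul_of_nonneg_right this h0]
  have h8 := mul_le_mul_of_nonneg_left h7 hμ
  linarith

theorem GoodSensing.norm_initSignal_sub_le {n m p : ℕ} {A : Fin p → Matrix (Fin m) (Fin n) ℝ}
    {xs : Vec n} {δ ρ : ℝ} {y : Fin p → Vec m} {ds : Vec m} (hm : 0 < m)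
    (hδ : 0 ≤ δ) (hρ0 : 0 ≤ ρ) (hρ : ρ ≤ 1 / 9)
    (hA : GoodSensing A xs (δ / 2))
    (hy : ∀ l i, y l i = ds i * inner ℝ (rowVec (A l) i) xs) (hds : ds ∈ gainSet m ρ) :
    ‖initSignal A y - xs‖ ≤ δ * ‖xs‖ := by
  have hds' := mem_gainSet.1 hds
  have hnorm : ‖ds - ones m‖ ≤ √m * ρ := by
    refine le_of_sq_le_sq ?_ (by positivity)
    rw [mul_pow, Real.sq_sqrt (Nat.cast_nonneg m), EuclideanSpace.norm_sq_eq]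
    calc ∑ i, ‖(ds - ones m) i‖ ^ 2 ≤ ∑ i : Fin m, ρ ^ 2 := by
          refine Finset.sum_le_sum fun i _ => pow_le_pow_left₀ (norm_nonneg _) ?_ 2
          simpa [ones] using hds'.2 i
      _ = _ := by simp
  have he0 : ∑ i, (ds - ones m) i = 0 := by simp [ones, hds'.1]
  set w := initSignal A y - xs with hw
  have h1 := (abs_le.1 (hA.cov w xs)).2
  have h2 := (abs_le.1 (hA.gain_cross w (ds - ones m) he0)).2
  have hsm : 0 < √(m : ℝ) := by positivity
  have h3 : ‖xs‖ / √m * ‖ds - ones m‖ ≤ ‖xs‖ * ρ := by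
    calc _ ≤ ‖xs‖ / √m * (√m * ρ) := by gcongr
      _ = _ := by field_simp
  have h4 : ‖w‖ ^ 2 ≤ δ / 2 * (‖w‖ * ‖xs‖) + δ / 2 * (‖w‖ * (‖xs‖ * ρ)) := by
    -- Splitting ds into the ones vector plus a zero-sum part turns the error of ξ₀ into a
    -- covariance deviation plus a gain cross term; with ρ ≤ 1 each contributes at most δ/2.
    have e : ‖w‖ ^ 2 = (1 / ((m : ℝ) * p) * ∑ j : Fin m × Fin p,
        inner ℝ (rowVec (A j.2) j.1) w * inner ℝ (rowVec (A j.2) j.1) xs - inner ℝ w xs)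
        + 1 / ((m : ℝ) * p) * ∑ j : Fin m × Fin p, (ds - ones m) j.1 *
          (inner ℝ (rowVec (A j.2) j.1) w * inner ℝ (rowVec (A j.2) j.1) xs) := by
      rw [← real_inner_self_eq_norm_sq]
      conv_lhs => rw [hw, inner_sub_left, ← hw]
      rw [inner_initSignal, real_inner_comm xs, sub_add_eq_add_sub, ← mul_add,
        ← Finset.sum_add_distrib]
      congr 2
      refine Finset.sum_congr rfl fun j _ => ?_
      rw [hy]
      simp [ones]
      ring
    rw [e]
    refine add_le_add h1 (h2.trans ?_)
    gcongr
  have h5 : δ / 2 * (‖w‖ * (‖xs‖ * ρ)) ≤ δ / 2 * (‖w‖ * (‖xs‖ * 1)) := by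
    gcongr; linarith
  rcases (norm_nonneg w).eq_or_lt with h | h
  · rw [← h]; positivity
  · have : ‖w‖ * ‖w‖ ≤ ‖w‖ * (δ * ‖xs‖) := by nlinarith
    exact le_of_mul_le_mul_left this h

theorem GoodSensing.dist2_init_le {n m p : ℕ} {A : Fin p → Matrix (Fin m) (Fin n) ℝ}
    {xs : Vec n} {δ ρ : ℝ} {y : Fin p → Vec m} {ds : Vec m} (hm : 0 < m)
    (hδ : 0 ≤ δ) (hρ0 : 0 ≤ ρ) (hρ : ρ ≤ 1 / 9)
    (hA : GoodSensing A xs (δ / 2))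
    (hy : ∀ l i, y l i = ds i * inner ℝ (rowVec (A l) i) xs) (hds : ds ∈ gainSet m ρ) :
    dist2 xs ds (initSignal A y) (ones m) ≤ (δ ^ 2 + ρ ^ 2) * ‖xs‖ ^ 2 := by
  have hm' : (0 : ℝ) < m := by positivity
  have h1 := pow_le_pow_left₀ (norm_nonneg _) (hA.norm_initSignal_sub_le hm hδ hρ0 hρ hy hds) 2
  have h2 : ‖ones m - ds‖ ^ 2 ≤ m * ρ ^ 2 := by
    rw [EuclideanSpace.norm_sq_eq]
    calc ∑ i, ‖(ones m - ds) i‖ ^ 2 ≤ ∑ i : Fin m, ρ ^ 2 := by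
          refine Finset.sum_le_sum fun i _ => pow_le_pow_left₀ (norm_nonneg _) ?_ 2
          simpa [ones, abs_sub_comm] using (mem_gainSet.1 hds).2 i
      _ = _ := by simp
  have h3 : ‖xs‖ ^ 2 / m * ‖ones m - ds‖ ^ 2 ≤ ‖xs‖ ^ 2 / m * (m * ρ ^ 2) := by gcongr
  have h4 : ‖xs‖ ^ 2 / m * (m * ρ ^ 2) = ρ ^ 2 * ‖xs‖ ^ 2 := by field_simp
  rw [dist2]
  linarith [mul_pow δ ‖xs‖ 2]

/-- Positivity comes from 1 - 2μ + 16μ², whose discriminant is negative; the step-size bound says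
exactly that the quadratic term is beaten by ημ. -/
theorem rate_mem_Ioo {L2 τ η μ : ℝ} (hL2 : 0 < L2) (hτ : 0 < τ) (hη2 : η ≤ 2)
    (hL : 16 ≤ L2 / τ) (hμ : 0 < μ) (hμ2 : μ < τ * η / L2) :
    0 < 1 - η * μ + L2 / τ * μ ^ 2 ∧ 1 - η * μ + L2 / τ * μ ^ 2 < 1 := by
  constructor
  · nlinarith [sq_nonneg (1 - 2 * μ), mul_le_mul_of_nonneg_right hL (sq_nonneg μ)]
  · have h : L2 / τ * μ < η := by
      rw [lt_div_iff₀ hL2] at hμ2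
      rw [div_mul_eq_mul_div, div_lt_iff₀ hτ]
      linarith
    nlinarith

/-- Linear convergence of projected gradient descent for well-behaved sensing matrices. -/
theorem GoodSensing.pgd_converges {n m p : ℕ} {A : Fin p → Matrix (Fin m) (Fin n) ℝ}
    {xs : Vec n} {δ ρ : ℝ} {y : Fin p → Vec m} {ds : Vec m} (hm : 0 < m) (hxs : xs ≠ 0)
    (hδ : 0 ≤ δ) (hρ0 : 0 ≤ ρ) (hρ : ρ < (1 - 2 * δ) / 9)
    (hA : GoodSensing A xs (δ / 2))
    (hy : ∀ l i, y l i = ds i * inner ℝ (rowVec (A l) i) xs) (hds : ds ∈ gainSet m ρ)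
    {μ : ℝ} (hμ : 0 < μ) (hμ2 : μ < tau m xs * eta δ ρ / lipL xs δ ρ ^ 2) :
    let z := pgd A y ρ μ (μ * ((m : ℝ) / ‖xs‖ ^ 2))
    let r := 1 - eta δ ρ * μ + lipL xs δ ρ ^ 2 / tau m xs * μ ^ 2
    (∀ k, z k ∈ nbhdD xs ds (kappa δ ρ) ρ) ∧
    (∀ k, dist2 xs ds (z k).1 (z k).2 ≤ r ^ k * ((δ ^ 2 + ρ ^ 2) * ‖xs‖ ^ 2)) ∧
    0 < r ∧ r < 1 ∧
    Tendsto (fun k => dist2 xs ds (z k).1 (z k).2) atTop (𝓝 0) ∧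
    Tendsto z atTop (𝓝 (xs, ds)) := by
  intro z r
  have hX := norm_pos_iff.2 hxs
  have hm' : (0 : ℝ) < m := by positivity
  have hδ2 : δ ≤ 1 / 2 := by linarith
  have hρ9 : ρ ≤ 1 / 9 := by linarith
  have hκ0 : 0 ≤ kappa δ ρ := Real.sqrt_nonneg _
  have hκ : kappa δ ρ ^ 2 = δ ^ 2 + ρ ^ 2 := Real.sq_sqrt (by positivity)
  have hL : 16 ≤ lipL xs δ ρ ^ 2 / tau m xs := by
    refine le_trans ?_ (le_lipL_sq_div_tau (δ := δ) hm hxs hρ0)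
    have : 0 ≤ 16 * (m * (1 + kappa δ ρ) ^ 2) := by positivity
    nlinarith
  have hL2 : 0 < lipL xs δ ρ ^ 2 := by rw [lipL]; positivity
  obtain ⟨hr0, hr1⟩ := rate_mem_Ioo hL2 (tau_pos hm hxs)
    (show eta δ ρ ≤ 2 by rw [eta]; linarith) hL hμ hμ2
  -- The rate and the invariance of the neighbourhood need each other: r^k ≤ 1 keeps the iterate
  -- where the next contraction step is valid.
  have hind : ∀ k, (z k).2 ∈ gainSet m ρ ∧
      dist2 xs ds (z k).1 (z k).2 ≤ r ^ k * ((δ ^ 2 + ρ ^ 2) * ‖xs‖ ^ 2) := by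
    intro k
    induction k with
    | zero =>
      refine ⟨mem_gainSet.2 ⟨by simp [z, pgd, ones], by simpa [z, pgd, ones] using fun _ => hρ0⟩, ?_⟩
      simpa [z, pgd] using hA.dist2_init_le hm hδ hρ0 hρ9 hy hds
    | succ k ih =>
      refine ⟨projGainSet_mem hρ0 _, ?_⟩
      have hzk : ((z k).1, (z k).2) ∈ nbhdD xs ds (kappa δ ρ) ρ := by
        refine ⟨ih.1, ih.2.trans ?_⟩
        rw [hκ]
        exact mul_le_of_le_one_left (by positivity) (pow_le_one₀ hr0.le hr1.le)
      refine (hA.dist2_step_le hm hxs hδ hδ2 hρ0 hρ9 hy hds hzk hμ.le).trans ?_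
      rw [pow_succ' r k, mul_assoc r]
      exact mul_le_mul_of_nonneg_left ih.2 hr0.le
  have hlim : Tendsto (fun k => dist2 xs ds (z k).1 (z k).2) atTop (𝓝 0) := by
    refine squeeze_zero (fun k => by rw [dist2]; positivity) (fun k => (hind k).2) ?_
    simpa using (tendsto_pow_atTop_nhds_zero_of_lt_one hr0.le hr1).mul_const
      ((δ ^ 2 + ρ ^ 2) * ‖xs‖ ^ 2)
  refine ⟨fun k => ⟨(hind k).1, (hind k).2.trans ?_⟩, fun k => (hind k).2, hr0, hr1, hlim, ?_⟩
  · rw [hκ]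
    exact mul_le_of_le_one_left (by positivity) (pow_le_one₀ hr0.le hr1.le)
  · have hsq : ∀ {E : Type} [NormedAddCommGroup E] {u : ℕ → E} {a : E},
        Tendsto (fun k => ‖u k - a‖ ^ 2) atTop (𝓝 0) → Tendsto u atTop (𝓝 a) := by
      intro E _ u a h
      rw [tendsto_iff_norm_sub_tendsto_zero]
      simpa [Real.sqrt_sq (norm_nonneg _)] using h.sqrt
    have h1 : Tendsto (fun k => (z k).1) atTop (𝓝 xs) := by
      refine hsq (squeeze_zero (fun k => sq_nonneg _) (fun k => ?_) hlim)
      rw [dist2]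
      exact le_add_of_nonneg_right (by positivity)
    have h2 : Tendsto (fun k => (z k).2) atTop (𝓝 ds) := by
      refine hsq (squeeze_zero (g := fun k => m / ‖xs‖ ^ 2 * dist2 xs ds (z k).1 (z k).2)
        (fun k => sq_nonneg _) (fun k => ?_) (by simpa using hlim.const_mul (m / ‖xs‖ ^ 2)))
      rw [dist2, mul_add]
      have : m / ‖xs‖ ^ 2 * (‖xs‖ ^ 2 / m * ‖(z k).2 - ds‖ ^ 2) = ‖(z k).2 - ds‖ ^ 2 := by
        field_simp
      rw [this]
      exact le_add_of_nonneg_left (by positivity)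
    exact h1.prodMk_nhds h2

/-! ### Exponential moments and Bernstein's inequality -/

section Moments

variable {Ω : Type*} [MeasurableSpace Ω] {P : Measure Ω}

theorem lintegral_enorm_pow_le_of_psi2Norm_le {X : Ω → ℝ} {K : ℝ} (hK : 0 ≤ K)
    (hX : psi2Norm P X ≤ ENNReal.ofReal K) {k : ℕ} (hk : 1 ≤ k) :
    ∫⁻ w, ‖X w‖ₑ ^ (2 * k) ∂P ≤ ENNReal.ofReal ((2 * k * K ^ 2) ^ k) := by
  have hk1 : (1 : ℝ) ≤ k := by exact_mod_cast hk
  have hq : (1 : ℝ) ≤ 2 * k := by linarith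
  have hq0 : ENNReal.ofReal (2 * k) ≠ 0 := by simp; positivity
  have h1 : eLpNorm X (ENNReal.ofReal (2 * k)) P / ENNReal.ofReal (√(2 * k))
      ≤ ENNReal.ofReal K :=
    (le_iSup₂ (f := fun (q : ℝ) (_ : 1 ≤ q) =>
      eLpNorm X (ENNReal.ofReal q) P / ENNReal.ofReal (√q)) (2 * (k : ℝ)) hq).trans hX
  rw [ENNReal.div_le_iff (by simp; positivity) ENNReal.ofReal_ne_top,
    ← ENNReal.ofReal_mul hK, eLpNorm_eq_lintegral_rpow_enorm_toReal hq0 ENNReal.ofReal_ne_top,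
    ENNReal.toReal_ofReal (by positivity)] at h1
  have h2 := ENNReal.rpow_le_rpow h1 (show (0 : ℝ) ≤ 2 * k by positivity)
  rw [← ENNReal.rpow_mul, one_div_mul_cancel (by positivity), ENNReal.rpow_one] at h2
  have e : ∀ a : ENNReal, a ^ (2 * (k : ℝ)) = a ^ (2 * k) := fun a => by
    rw [← ENNReal.rpow_natCast]; push_cast; rfl
  simp only [e] at h2
  refine h2.trans_eq ?_
  rw [← ENNReal.ofReal_pow (by positivity), pow_mul, mul_pow, Real.sq_sqrt (by positivity),
    mul_comm]

/-- Integrate the power series termwise. Moments of order 2k with k^k/k! ≤ e^k bound the k-th term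
by (2eθK²)^k ≤ 2⁻ᵏ, whose sum is 2. -/
theorem lintegral_exp_mul_sq_le [IsProbabilityMeasure P] {X : Ω → ℝ} (hXm : Measurable X)
    {K θ : ℝ} (hK : 0 ≤ K) (hθ : 0 ≤ θ) (hθK : 4 * Real.exp 1 * θ * K ^ 2 ≤ 1)
    (hX : psi2Norm P X ≤ ENNReal.ofReal K) :
    ∫⁻ w, ENNReal.ofReal (Real.exp (θ * X w ^ 2)) ∂P ≤ 2 := by
  have hterm : ∀ k : ℕ, ∫⁻ w, ENNReal.ofReal ((θ * X w ^ 2) ^ k / k.factorial) ∂P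
      ≤ 2⁻¹ ^ k := by
    intro k
    rcases Nat.eq_zero_or_pos k with rfl | hk
    · simp
    have h1 : ∀ w, ENNReal.ofReal ((θ * X w ^ 2) ^ k / k.factorial)
        = ENNReal.ofReal (θ ^ k / k.factorial) * ‖X w‖ₑ ^ (2 * k) := by
      intro w
      rw [← ofReal_norm, ← ENNReal.ofReal_pow (norm_nonneg _),
        ← ENNReal.ofReal_mul (by positivity), pow_mul, Real.norm_eq_abs, sq_abs]
      congr 1; ring
    simp only [h1]
    rw [lintegral_const_mul' _ _ ENNReal.ofReal_ne_top]
    calc _ ≤ ENNReal.ofReal (θ ^ k / k.factorial) * ENNReal.ofReal ((2 * k * K ^ 2) ^ k) := by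
          gcongr
          exact lintegral_enorm_pow_le_of_psi2Norm_le hK hX hk
      _ = ENNReal.ofReal ((2 * θ * K ^ 2) ^ k * ((k : ℝ) ^ k / k.factorial)) := by
          rw [← ENNReal.ofReal_mul (by positivity)]
          congr 1
          simp only [mul_pow]
          ring
      _ ≤ ENNReal.ofReal ((2 * θ * K ^ 2) ^ k * Real.exp k) := by
          gcongr
          exact Real.pow_div_factorial_le_exp _ (by positivity) k
      _ = ENNReal.ofReal (2 * θ * K ^ 2 * Real.exp 1) ^ k := by
          rw [← ENNReal.ofReal_pow (by positivity), mul_pow _ (Real.exp 1), ← Real.exp_nat_mul,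
            mul_one]
      _ ≤ 2⁻¹ ^ k := by
          gcongr
          rw [show (2⁻¹ : ENNReal) = ENNReal.ofReal (2⁻¹) by
            rw [ENNReal.ofReal_inv_of_pos two_pos]; simp]
          exact ENNReal.ofReal_le_ofReal (by linarith)
  have hexp : ∀ w, ENNReal.ofReal (Real.exp (θ * X w ^ 2))
      = ∑' k : ℕ, ENNReal.ofReal ((θ * X w ^ 2) ^ k / k.factorial) := by
    intro w
    have hs := NormedSpace.expSeries_div_hasSum_exp (θ * X w ^ 2)
    rw [← Real.exp_eq_exp_ℝ] at hs
    rw [← ENNReal.ofReal_tsum_of_nonneg (fun k => by positivity) hs.summable, hs.tsum_eq]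
  simp only [hexp]
  rw [lintegral_tsum fun k => by fun_prop]
  refine (ENNReal.tsum_le_tsum hterm).trans_eq ?_
  rw [ENNReal.tsum_geometric]
  simp

theorem lintegral_exp_mul_inner_sq_le [IsProbabilityMeasure P] {n : ℕ} {a : Ω → Vec n}
    (ham : Measurable a) {K θ : ℝ} (hK : 0 ≤ K) (hθ : 0 ≤ θ)
    (hθK : 4 * Real.exp 1 * θ * K ^ 2 ≤ 1) (ha : psi2NormVec P a ≤ ENNReal.ofReal K)
    {h : Vec n} (hh : ‖h‖ ≤ 1) :
    ∫⁻ w, ENNReal.ofReal (Real.exp (θ * inner ℝ (a w) h ^ 2)) ∂P ≤ 2 := by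
  by_cases h0 : h = 0
  · simp [h0]
  have hn := norm_pos_iff.2 h0
  have hu : ‖(‖h‖⁻¹ • h : Vec n)‖ = 1 := by
    rw [norm_smul, norm_inv, norm_norm, inv_mul_cancel₀ hn.ne']
  have h1 : psi2Norm P (fun w => inner ℝ (a w) (‖h‖⁻¹ • h)) ≤ ENNReal.ofReal K :=
    (le_iSup₂ (f := fun (u : Vec n) (_ : ‖u‖ = 1) => psi2Norm P (fun w => inner ℝ (a w) u))
      _ hu).trans ha
  refine le_trans (lintegral_mono fun w => ?_)
    (lintegral_exp_mul_sq_le (by fun_prop) hK hθ hθK h1)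
  refine ENNReal.ofReal_le_ofReal (Real.exp_le_exp.2 (mul_le_mul_of_nonneg_left ?_ hθ))
  rw [inner_smul_right, mul_pow]
  exact le_mul_of_one_le_left (sq_nonneg _) (one_le_pow₀ ((one_le_inv₀ hn).2 hh))

theorem exp_le_one_add_add_sq_mul_exp_abs (x : ℝ) :
    Real.exp x ≤ 1 + x + x ^ 2 * Real.exp |x| := by
  have h1 : 1 ≤ Real.exp |x| := Real.one_le_exp (abs_nonneg _)
  have h2 := mul_le_mul_of_nonneg_left h1 (sq_nonneg x)
  rcases le_or_gt |x| 1 with hx | hx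
  · have := (abs_le.1 (Real.abs_exp_sub_one_sub_id_le hx)).2
    linarith
  · rcases lt_abs.1 hx with hx' | hx'
    · rw [abs_of_pos (by linarith)] at *
      have : 1 ≤ x ^ 2 := one_le_pow₀ hx'.le
      nlinarith [Real.exp_pos x]
    · have : Real.exp x ≤ 1 := Real.exp_le_one_iff.2 (by linarith)
      nlinarith

/-- In e^x ≤ 1 + x + x²e^{|x|} the linear term vanishes by centring. One factor e^{s|Z|} pays for
Z², the other for e^{|tZ|}, which is why the hypothesis carries 2s. -/
theorem mgf_le_of_exp_abs_le [IsProbabilityMeasure P] {Z W : Ω → ℝ} (hZ : Measurable Z)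
    (hZ0 : ∫ w, Z w ∂P = 0) {s B : ℝ} (hs : 0 < s) (hW : Integrable W P)
    (hZW : ∀ w, Real.exp (2 * s * |Z w|) ≤ W w) (hB : ∫ w, W w ∂P ≤ B) {t : ℝ} (ht : |t| ≤ s) :
    Integrable (fun w => Real.exp (t * Z w)) P ∧ mgf Z P t ≤ Real.exp (2 * B / s ^ 2 * t ^ 2) := by
  have hb : ∀ w, Real.exp (t * Z w) ≤ 1 + t * Z w + t ^ 2 * (2 / s ^ 2) * W w := by
    intro w
    refine (exp_le_one_add_add_sq_mul_exp_abs _).trans (add_le_add_right ?_ _)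
    have h1 : Real.exp |t * Z w| ≤ Real.exp (s * |Z w|) := by
      rw [abs_mul]
      exact Real.exp_le_exp.2 (mul_le_mul_of_nonneg_right ht (abs_nonneg _))
    have h2 : Z w ^ 2 ≤ 2 / s ^ 2 * Real.exp (s * |Z w|) := by
      have hp : 0 ≤ s * |Z w| := by positivity
      have := Real.quadratic_le_exp_of_nonneg hp
      rw [div_mul_eq_mul_div, le_div_iff₀ (by positivity)]
      rw [mul_pow, sq_abs] at this
      linarith
    calc (t * Z w) ^ 2 * Real.exp |t * Z w|
        ≤ t ^ 2 * (2 / s ^ 2 * Real.exp (s * |Z w|)) * Real.exp (s * |Z w|) := by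
          rw [mul_pow]; gcongr
      _ = t ^ 2 * (2 / s ^ 2) * Real.exp (2 * s * |Z w|) := by
          rw [show 2 * s * |Z w| = s * |Z w| + s * |Z w| by ring, Real.exp_add]; ring
      _ ≤ _ := by gcongr; exact hZW w
  have hZi : Integrable Z P := by
    refine (hW.const_mul (1 / (2 * s))).mono' hZ.aestronglyMeasurable (ae_of_all _ fun w => ?_)
    have h1 := Real.add_one_le_exp (2 * s * |Z w|)
    have h2 := hZW w
    rw [Real.norm_eq_abs, one_div_mul_eq_div, le_div_iff₀ (by positivity)]
    linarith
  have hint : Integrable (fun w => 1 + t * Z w + t ^ 2 * (2 / s ^ 2) * W w) P :=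
    ((integrable_const _).add (hZi.const_mul t)).add (hW.const_mul _)
  have hexp : Integrable (fun w => Real.exp (t * Z w)) P := by
    refine hint.mono' (by fun_prop) (ae_of_all _ fun w => ?_)
    rw [Real.norm_eq_abs, abs_of_pos (Real.exp_pos _)]
    exact hb w
  refine ⟨hexp, ?_⟩
  calc mgf Z P t ≤ ∫ w, (1 + t * Z w + t ^ 2 * (2 / s ^ 2) * W w) ∂P :=
        integral_mono hexp hint hb
    _ = 1 + t ^ 2 * (2 / s ^ 2) * ∫ w, W w ∂P := by
        rw [integral_add (by exact (integrable_const _).add (hZi.const_mul t)) (hW.const_mul _),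
          integral_add (integrable_const _) (hZi.const_mul t), integral_const_mul,
          integral_const_mul, hZ0]
        simp
    _ ≤ 1 + t ^ 2 * (2 / s ^ 2) * B := by gcongr
    _ = 2 * B / s ^ 2 * t ^ 2 + 1 := by ring
    _ ≤ _ := Real.add_one_le_exp _

end Moments

/-- Bernstein's inequality for weighted sums of independent sub-exponential variables. -/
theorem measure_le_abs_sum_le {Ω ι : Type*} [MeasurableSpace Ω] {P : Measure Ω}
    [IsProbabilityMeasure P] [Fintype ι] {Z : ι → Ω → ℝ} (hZ : ∀ j, Measurable (Z j))
    (hind : iIndepFun Z P) {s M : ℝ} (hs : 0 < s) (hM : 0 < M)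
    (hmgf : ∀ j t, |t| ≤ s → Integrable (fun w => Real.exp (t * Z j w)) P ∧
      mgf (Z j) P t ≤ Real.exp (M * t ^ 2))
    {N ε : ℝ} (hN : 0 ≤ N) (hε : 0 ≤ ε) (hε1 : ε ≤ 1) (c : ι → ℝ)
    (hc : ∀ j, N * |c j| ≤ 1) (hc2 : N * ∑ j, c j ^ 2 ≤ 1) :
    P.real {w | ε ≤ |∑ j, c j * Z j w|} ≤ 2 * Real.exp (-(min s (1 / (2 * M)) / 2 * N * ε ^ 2)) := by
  set q := min s (1 / (2 * M))
  have hq : 0 < q := by positivity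
  have hqs : q ≤ s := min_le_left _ _
  have hqM : M * q ≤ 1 / 2 := by
    have : q ≤ 1 / (2 * M) := min_le_right _ _
    calc M * q ≤ M * (1 / (2 * M)) := by gcongr
      _ = 1 / 2 := by field_simp
  have one_side : ∀ c : ι → ℝ, (∀ j, N * |c j| ≤ 1) → N * ∑ j, c j ^ 2 ≤ 1 →
      P.real {w | ε ≤ ∑ j, c j * Z j w} ≤ Real.exp (-(q / 2 * N * ε ^ 2)) := by
    intro c hc hc2
    set Y : ι → Ω → ℝ := fun j w => c j * Z j w with hY
    have hYm : ∀ j, Measurable (Y j) := fun j => (hZ j).const_mul _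
    have hYi : iIndepFun Y P := hind.comp (fun j x => c j * x) (fun j => by fun_prop)
    -- N is an effective sample size. This t keeps each |t c_j| ≤ s, and Mq ≤ 1/2 makes the
    -- quadratic term at most half of tε.
    set t := N * (q * ε)
    have ht : 0 ≤ t := by positivity
    have htc : ∀ j, |t * c j| ≤ s := fun j => by
      rw [abs_mul, abs_of_nonneg ht]
      calc t * |c j| = q * ε * (N * |c j|) := by ring
        _ ≤ s * 1 * 1 := by gcongr; exact hc j
        _ = s := by ring
    have hYint : ∀ j, Integrable (fun w => Real.exp (t * Y j w)) P := fun j => by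
      simpa only [hY, ← mul_assoc] using (hmgf j _ (htc j)).1
    have hSint := hYi.integrable_exp_mul_sum hYm (s := Finset.univ) (t := t) fun j _ => hYint j
    have hmain := measure_ge_le_exp_mul_mgf ε ht hSint
    rw [hYi.mgf_sum hYm] at hmain
    have hprod : ∏ j, mgf (Y j) P t ≤ Real.exp (M * t ^ 2 * ∑ j, c j ^ 2) := by
      rw [Finset.mul_sum, Real.exp_sum]
      refine Finset.prod_le_prod (fun j _ => mgf_nonneg) fun j _ => ?_
      rw [hY, mgf_const_mul, mul_comm (c j)]
      refine (hmgf j _ (htc j)).2.trans_eq ?_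
      congr 1; ring
    have hset : {w | ε ≤ ∑ j, c j * Z j w} = {w | ε ≤ (∑ j, Y j) w} := by
      simp [hY, Finset.sum_apply]
    rw [hset]
    refine hmain.trans ((mul_le_mul_of_nonneg_left hprod (Real.exp_pos _).le).trans ?_)
    rw [← Real.exp_add, Real.exp_le_exp]
    have e1 : M * t ^ 2 * ∑ j, c j ^ 2 = (M * q) * (q * N * ε ^ 2) * (N * ∑ j, c j ^ 2) := by
      simp only [t]; ring
    have e2 : (M * q) * (q * N * ε ^ 2) * (N * ∑ j, c j ^ 2) ≤ 1 / 2 * (q * N * ε ^ 2) * 1 := by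
      gcongr
    rw [e1]
    have e3 : -t * ε = -(q * N * ε ^ 2) := by simp only [t]; ring
    linarith
  have hsub : {w | ε ≤ |∑ j, c j * Z j w|} ⊆
      {w | ε ≤ ∑ j, c j * Z j w} ∪ {w | ε ≤ ∑ j, (-c j) * Z j w} := by
    intro w hw
    simp only [Set.mem_ofPred_eq, Set.mem_union, neg_mul, Finset.sum_neg_distrib] at hw ⊢
    exact le_abs.1 hw
  calc _ ≤ P.real ({w | ε ≤ ∑ j, c j * Z j w} ∪ {w | ε ≤ ∑ j, (-c j) * Z j w}) :=
        measureReal_mono hsub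
    _ ≤ _ := measureReal_union_le _ _
    _ ≤ _ := add_le_add (one_side c hc hc2)
        (one_side (fun j => -c j) (by simpa using hc) (by simpa using hc2))
    _ = _ := by ring

/-! ### Nets and passage to all vectors -/

section Net

variable {E F : Type*} [NormedAddCommGroup E] [InnerProductSpace ℝ E] [FiniteDimensional ℝ E]
  [NormedAddCommGroup F] [InnerProductSpace ℝ F] [FiniteDimensional ℝ F]

/-- `N` is a `1/2`-net of the closed unit ball. -/
structure IsHalfNet {E : Type*} [NormedAddCommGroup E] (N : Finset E) : Prop where
  norm_le : ∀ x ∈ N, ‖x‖ ≤ 1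
  dense : ∀ x, ‖x‖ ≤ 1 → ∃ y ∈ N, ‖x - y‖ ≤ 1 / 2

variable (E) in
-- A maximal 1/2-separated subset of the unit ball is a net. Doubling it gives 1-separated points in
-- the ball of radius 2, where the packing bound 5^dim applies; that bound also ensures a maximal
-- set exists.
theorem exists_isHalfNet :
    ∃ N : Finset E, IsHalfNet N ∧ N.card ≤ 5 ^ Module.finrank ℝ E := by
  classical
  let sep : Finset E → Prop := fun N =>
    (∀ x ∈ N, ‖x‖ ≤ 1) ∧ ∀ x ∈ N, ∀ y ∈ N, x ≠ y → 1 / 2 ≤ ‖x - y‖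
  have hcard : ∀ N, sep N → N.card ≤ 5 ^ Module.finrank ℝ E := by
    intro N hN
    have hinj : Function.Injective (fun x : E => (2 : ℝ) • x) :=
      smul_right_injective E two_ne_zero
    rw [← Finset.card_image_of_injective N hinj]
    refine Besicovitch.card_le_of_separated _ ?_ ?_
    · intro c hc
      obtain ⟨x, hx, rfl⟩ := Finset.mem_image.1 hc
      rw [norm_smul, Real.norm_two]
      linarith [hN.1 x hx]
    · intro c hc d hd hcd
      obtain ⟨x, hx, rfl⟩ := Finset.mem_image.1 hc
      obtain ⟨y, hy, rfl⟩ := Finset.mem_image.1 hd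
      rw [← smul_sub, norm_smul, Real.norm_two]
      linarith [hN.2 x hx y hy fun h => hcd (by rw [h])]
  let q : ℕ → Prop := fun k => ∃ N, sep N ∧ N.card = k
  have hq0 : q 0 := ⟨∅, ⟨by simp, by simp⟩, rfl⟩
  obtain ⟨N, hN, hNk⟩ := Nat.findGreatest_spec (P := q) (Nat.zero_le (5 ^ Module.finrank ℝ E)) hq0
  refine ⟨N, ⟨hN.1, fun x hx => ?_⟩, hcard N hN⟩
  by_contra! hfar
  have hxN : x ∉ N := fun h => by
    have := hfar x h
    norm_num at this
  have hsep : sep (insert x N) := by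
    refine ⟨?_, ?_⟩
    · simpa [hx] using hN.1
    · intro a ha b hb hab
      rw [Finset.mem_insert] at ha hb
      rcases ha with rfl | ha <;> rcases hb with rfl | hb
      · exact absurd rfl hab
      · exact (hfar b hb).le
      · rw [norm_sub_rev]; exact (hfar a ha).le
      · exact hN.2 a ha b hb hab
  have := Nat.le_findGreatest (P := q) (hcard _ hsep) ⟨_, hsep, rfl⟩
  rw [Finset.card_insert_of_notMem hxN, ← hNk] at this
  omega

/-- Approximating a unit vector by a net point gives ‖φ‖ ≤ ε + ‖φ‖/2. Each linear slot therefore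
costs a factor 2. -/
theorem IsHalfNet.abs_le_of_linear {N : Finset E} (hN : IsHalfNet N) {f : E → ℝ}
    (hf : IsLinearMap ℝ f) {ε : ℝ} (h : ∀ x ∈ N, |f x| ≤ ε) (x : E) :
    |f x| ≤ 2 * ε * ‖x‖ := by
  let φ : E →L[ℝ] ℝ := LinearMap.toContinuousLinearMap (hf.mk' f)
  have hφ : ∀ x, φ x = f x := fun x => rfl
  have hε : 0 ≤ ε := by
    obtain ⟨y, hy, -⟩ := hN.dense 0 (by simp)
    exact (abs_nonneg _).trans (h y hy)
  have h1 : ‖φ‖ ≤ ε + ‖φ‖ * (1 / 2) := by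
    refine φ.opNorm_le_of_unit_norm (by positivity) fun z hz => ?_
    obtain ⟨y, hy, hyz⟩ := hN.dense z hz.le
    calc ‖φ z‖ = ‖φ y + φ (z - y)‖ := by rw [← map_add]; congr 2; abel
      _ ≤ ‖φ y‖ + ‖φ (z - y)‖ := norm_add_le _ _
      _ ≤ ε + ‖φ‖ * (1 / 2) := by
          gcongr
          · rw [hφ]; exact h y hy
          · exact (φ.le_opNorm _).trans (by gcongr)
  rw [← hφ, ← Real.norm_eq_abs]
  refine (φ.le_opNorm x).trans ?_
  gcongr
  linarith

theorem IsHalfNet.abs_le_of_bilinear {N : Finset E} (hN : IsHalfNet N) {N' : Finset F}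
    (hN' : IsHalfNet N') {f : E → F → ℝ} (hf : ∀ y, IsLinearMap ℝ fun x => f x y)
    (hf' : ∀ x, IsLinearMap ℝ (f x)) {ε : ℝ} (h : ∀ x ∈ N, ∀ y ∈ N', |f x y| ≤ ε)
    (x : E) (y : F) : |f x y| ≤ 4 * ε * (‖x‖ * ‖y‖) := by
  have h1 : ∀ x ∈ N, |f x y| ≤ 2 * ε * ‖y‖ := fun x hx =>
    hN'.abs_le_of_linear (hf' x) (h x hx) y
  refine (hN.abs_le_of_linear (hf y) h1 x).trans_eq (by ring)

end Net

/-- Normalising x⋆ to u makes all test vectors lie in the unit ball. The covariance and gain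
deviations are bilinear, hence the 4; the row bounds involve only u and need no net. -/
theorem GoodSensing.of_nets {n m p : ℕ} {A : Fin p → Matrix (Fin m) (Fin n) ℝ} {xs : Vec n}
    (hxs : xs ≠ 0) {ε : ℝ} {N : Finset (Vec n)} {N' : Finset (Vec m)}
    (hp : 0 < p) (hm : 0 < m) (hN : IsHalfNet N) (hN' : IsHalfNet N') {u : Vec n}
    (hu : u = ‖xs‖⁻¹ • xs)
    (hr : ∀ i : Fin m, |∑ j : Fin m × Fin p, (if j.1 = i then 1 / (p : ℝ) else 0) *
      (inner ℝ (rowVec (A j.2) j.1) u * inner ℝ (rowVec (A j.2) j.1) u - inner ℝ u u)| ≤ ε)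
    (hc : ∀ h ∈ N, ∀ h' ∈ N, |∑ j : Fin m × Fin p, 1 / ((m : ℝ) * p) *
      (inner ℝ (rowVec (A j.2) j.1) h * inner ℝ (rowVec (A j.2) j.1) h' - inner ℝ h h')| ≤ ε)
    (hg : ∀ h ∈ N, ∀ g ∈ N', |∑ j : Fin m × Fin p, g j.1 / (√m * p) *
      (inner ℝ (rowVec (A j.2) j.1) h * inner ℝ (rowVec (A j.2) j.1) u - inner ℝ h u)| ≤ ε) :
    GoodSensing A xs (4 * ε) := by
  have hX := norm_pos_iff.2 hxs
  have hxu : xs = ‖xs‖ • u := by rw [hu, smul_smul, mul_inv_cancel₀ hX.ne', one_smul]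
  have huu : inner ℝ u u = (1 : ℝ) := by
    rw [real_inner_self_eq_norm_sq, hu, norm_smul, norm_inv, norm_norm,
      inv_mul_cancel₀ hX.ne', one_pow]
  have hm' : (m : ℝ) ≠ 0 := by positivity
  have hp' : (p : ℝ) ≠ 0 := by positivity
  refine ⟨fun i => ?_, fun h h' => ?_, fun h g => ?_⟩
  · have h1 := hr i
    have hε : 0 ≤ ε := (abs_nonneg _).trans h1
    have e : 1 / (p : ℝ) * ∑ l, inner ℝ (rowVec (A l) i) xs ^ 2 - ‖xs‖ ^ 2
        = ‖xs‖ ^ 2 * ∑ j : Fin m × Fin p, (if j.1 = i then 1 / (p : ℝ) else 0) *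
      (inner ℝ (rowVec (A j.2) j.1) u * inner ℝ (rowVec (A j.2) j.1) u - inner ℝ u u) := by
      rw [Fintype.sum_prod_type, Finset.sum_eq_single i (by
        intro b _ hb; simp [hb]) (by simp)]
      have hS : ∀ l, inner ℝ (rowVec (A l) i) xs = ‖xs‖ * inner ℝ (rowVec (A l) i) u := fun l => by
        conv_lhs => rw [hxu, inner_smul_right]
      simp only [hS, huu, if_true, mul_sub, Finset.sum_sub_distrib, ← Finset.mul_sum, mul_pow,
        ← pow_two]
      simp
      field_simp
    rw [e, abs_mul, abs_of_nonneg (sq_nonneg _), mul_comm]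
    refine mul_le_mul_of_nonneg_right (h1.trans (by linarith)) (sq_nonneg _)
  · have e : 1 / ((m : ℝ) * p) * ∑ j : Fin m × Fin p,
        inner ℝ (rowVec (A j.2) j.1) h * inner ℝ (rowVec (A j.2) j.1) h' - inner ℝ h h'
        = ∑ j : Fin m × Fin p, 1 / ((m : ℝ) * p) *
      (inner ℝ (rowVec (A j.2) j.1) h * inner ℝ (rowVec (A j.2) j.1) h' - inner ℝ h h') := by
      rw [← Finset.mul_sum, Finset.sum_sub_distrib]
      simp
      field_simp
    rw [e]
    refine hN.abs_le_of_bilinear hN (f := fun h h' => ∑ j : Fin m × Fin p, 1 / ((m : ℝ) * p) *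
      (inner ℝ (rowVec (A j.2) j.1) h * inner ℝ (rowVec (A j.2) j.1) h' - inner ℝ h h'))
      (fun y => ⟨fun a b => ?_, fun c a => ?_⟩) (fun y => ⟨fun a b => ?_, fun c a => ?_⟩) hc h h'
    · rw [← Finset.sum_add_distrib]
      refine Finset.sum_congr rfl fun j _ => ?_
      rw [inner_add_right, inner_add_left]; ring
    · rw [smul_eq_mul, Finset.mul_sum]
      refine Finset.sum_congr rfl fun j _ => ?_
      rw [inner_smul_right, real_inner_smul_left]; ring
    · rw [← Finset.sum_add_distrib]
      refine Finset.sum_congr rfl fun j _ => ?_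
      rw [inner_add_right, inner_add_right]; ring
    · rw [smul_eq_mul, Finset.mul_sum]
      refine Finset.sum_congr rfl fun j _ => ?_
      rw [inner_smul_right, inner_smul_right]; ring
  · have e : 1 / (√m * p) * ∑ j : Fin m × Fin p, g j.1 *
        (inner ℝ (rowVec (A j.2) j.1) h * inner ℝ (rowVec (A j.2) j.1) xs - inner ℝ h xs)
        = ‖xs‖ * ∑ j : Fin m × Fin p, g j.1 / (√m * p) *
      (inner ℝ (rowVec (A j.2) j.1) h * inner ℝ (rowVec (A j.2) j.1) u - inner ℝ h u) := by
      rw [Finset.mul_sum, Finset.mul_sum]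
      refine Finset.sum_congr rfl fun j _ => ?_
      have hS : ∀ v : Vec n, inner ℝ v xs = ‖xs‖ * inner ℝ v u := fun v => by
        conv_lhs => rw [hxu, inner_smul_right]
      rw [hS, hS]; ring
    have key := hN.abs_le_of_bilinear hN' (f := fun h g => ∑ j : Fin m × Fin p,
      g j.1 / (√m * p) *
      (inner ℝ (rowVec (A j.2) j.1) h * inner ℝ (rowVec (A j.2) j.1) u - inner ℝ h u))
      (fun y => ⟨fun a b => ?_, fun c a => ?_⟩) (fun y => ⟨fun a b => ?_, fun c a => ?_⟩) hg h g
    · rw [e, abs_mul, abs_of_pos hX]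
      calc _ ≤ ‖xs‖ * (4 * ε * (‖h‖ * ‖g‖)) := mul_le_mul_of_nonneg_left key hX.le
        _ = _ := by ring
    · rw [← Finset.sum_add_distrib]
      refine Finset.sum_congr rfl fun j _ => ?_
      rw [inner_add_right, inner_add_left]; ring
    · rw [smul_eq_mul, Finset.mul_sum]
      refine Finset.sum_congr rfl fun j _ => ?_
      rw [inner_smul_right, real_inner_smul_left]; ring
    · rw [← Finset.sum_add_distrib]
      refine Finset.sum_congr rfl fun j _ => ?_
      rw [PiLp.add_apply]; ring
    · rw [smul_eq_mul, Finset.mul_sum]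
      refine Finset.sum_congr rfl fun j _ => ?_
      rw [PiLp.smul_apply, smul_eq_mul]; ring

/-! ### Concentration for the random model -/

/-- A rate `θ` for which the squared marginals of a sub-Gaussian vector with norm at most `K`
have `E exp(θ ⟨a, u⟩²) ≤ 2`. -/
def sqRate (K : ℝ) : ℝ := 1 / (4 * Real.exp 1 * K ^ 2)

/-- The constant in the sub-exponential moment generating function of products of marginals. -/
def mgfConst (K : ℝ) : ℝ := 2 * (2 * Real.exp (sqRate K)) / (sqRate K / 2) ^ 2

/-- The constant in the exponent of Bernstein's inequality for products of marginals. -/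
def tailConst (K : ℝ) : ℝ := min (sqRate K / 2) (1 / (2 * mgfConst K)) / 2

theorem sqRate_pos {K : ℝ} (hK : 0 < K) : 0 < sqRate K := by rw [sqRate]; positivity

theorem mgfConst_pos {K : ℝ} (hK : 0 < K) : 0 < mgfConst K := by
  have := sqRate_pos hK
  rw [mgfConst]; positivity

theorem tailConst_pos {K : ℝ} (hK : 0 < K) : 0 < tailConst K := by
  have := sqRate_pos hK
  have := mgfConst_pos hK
  rw [tailConst]; positivity

namespace IsSensingModel

variable {Ω : Type*} [MeasurableSpace Ω] {P : Measure Ω} [IsProbabilityMeasure P] {n m p : ℕ}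
  {A : Fin p → Ω → Matrix (Fin m) (Fin n) ℝ} {K : ℝ}

theorem integrable_exp (hA : IsSensingModel P A K) (hK : 0 < K) (i : Fin m) (l : Fin p)
    {h : Vec n} (hh : ‖h‖ ≤ 1) :
    Integrable (fun w => Real.exp (sqRate K * inner ℝ (rowVec (A l w) i) h ^ 2)) P ∧
      ∫ w, Real.exp (sqRate K * inner ℝ (rowVec (A l w) i) h ^ 2) ∂P ≤ 2 := by
  have ham := hA.measurable i l
  have h1 := lintegral_exp_mul_inner_sq_le ham hK.le (sqRate_pos hK).le
    (by rw [sqRate]; field_simp; rfl) (hA.subGaussian i l) hh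
  have hm : AEStronglyMeasurable
      (fun w => Real.exp (sqRate K * inner ℝ (rowVec (A l w) i) h ^ 2)) P :=
    Measurable.aestronglyMeasurable (by fun_prop)
  have hnn : 0 ≤ᵐ[P] fun w => Real.exp (sqRate K * inner ℝ (rowVec (A l w) i) h ^ 2) :=
    ae_of_all _ fun w => (Real.exp_pos _).le
  refine ⟨(lintegral_ofReal_ne_top_iff_integrable hm hnn).1 (h1.trans_lt (by simp)).ne, ?_⟩
  rw [integral_eq_lintegral_of_nonneg_ae hnn hm]
  exact ENNReal.toReal_le_of_le_ofReal two_pos.le (h1.trans_eq (by simp))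

theorem memLp_apply (hA : IsSensingModel P A K) (hK : 0 < K) (i : Fin m) (l : Fin p)
    (j : Fin n) : MemLp (fun w => rowVec (A l w) i j) 2 P := by
  have ham := hA.measurable i l
  have hm : Measurable (fun w => rowVec (A l w) i j) :=
    (show Measurable fun v : Vec n => v j by fun_prop).comp ham
  rw [memLp_two_iff_integrable_sq hm.aestronglyMeasurable]
  have h1 := (hA.integrable_exp hK i l (h := EuclideanSpace.single j 1) (by simp)).1
  have hθ := sqRate_pos hK
  refine (h1.const_mul (1 / sqRate K)).mono' (hm.pow_const 2).aestronglyMeasurable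
    (ae_of_all _ fun w => ?_)
  rw [Real.norm_eq_abs, abs_of_nonneg (sq_nonneg _), one_div_mul_eq_div, le_div_iff₀ hθ]
  have h2 := Real.add_one_le_exp
    (sqRate K * inner ℝ (rowVec (A l w) i) (EuclideanSpace.single j 1) ^ 2)
  simp [EuclideanSpace.inner_single_right] at h2 ⊢
  linarith

theorem integral_inner_mul_inner (hA : IsSensingModel P A K) (hK : 0 < K) (i : Fin m)
    (l : Fin p) (h h' : Vec n) :
    ∫ w, (inner ℝ (rowVec (A l w) i) h * inner ℝ (rowVec (A l w) i) h' - inner ℝ h h') ∂P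
      = 0 := by
  have hint : ∀ j k, Integrable
      (fun w => h j * h' k * (rowVec (A l w) i j * rowVec (A l w) i k)) P := fun j k =>
    ((hA.memLp_apply hK i l j).integrable_mul (hA.memLp_apply hK i l k)).const_mul _
  have e : ∀ w, inner ℝ (rowVec (A l w) i) h * inner ℝ (rowVec (A l w) i) h'
      = ∑ j, ∑ k, h j * h' k * (rowVec (A l w) i j * rowVec (A l w) i k) := by
    intro w
    simp only [PiLp.inner_apply, RCLike.inner_apply, conj_trivial, Finset.sum_mul_sum]
    refine Finset.sum_congr rfl fun j _ => Finset.sum_congr rfl fun k _ => by ring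
  simp only [e]
  rw [integral_sub (integrable_finsetSum _ fun j _ => integrable_finsetSum _ fun k _ => hint j k)
    (integrable_const _), integral_finsetSum _ fun j _ => integrable_finsetSum _ fun k _ => hint j k]
  simp only [integral_finsetSum _ fun k _ => hint _ k, integral_const_mul, hA.isotropic]
  simp [PiLp.inner_apply, mul_comm]

/-- By |uv| ≤ (u² + v²)/2 and AM–GM, the exponential of the product is dominated by the mean of the
two squared-marginal exponentials; centring by an inner product of size at most 1 costs e^θ with θ =
`sqRate K`. -/
theorem mgf_le (hA : IsSensingModel P A K) (hK : 0 < K) (i : Fin m) (l : Fin p) {h h' : Vec n}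
    (hh : ‖h‖ ≤ 1) (hh' : ‖h'‖ ≤ 1) {t : ℝ} (ht : |t| ≤ sqRate K / 2) :
    Integrable (fun w => Real.exp (t * (inner ℝ (rowVec (A l w) i) h *
      inner ℝ (rowVec (A l w) i) h' - inner ℝ h h'))) P ∧
    mgf (fun w => inner ℝ (rowVec (A l w) i) h * inner ℝ (rowVec (A l w) i) h' - inner ℝ h h') P t
      ≤ Real.exp (mgfConst K * t ^ 2) := by
  have ham := hA.measurable i l
  have hθ := sqRate_pos hK
  obtain ⟨h1, h1'⟩ := hA.integrable_exp hK i l hh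
  obtain ⟨h2, h2'⟩ := hA.integrable_exp hK i l hh'
  refine mgf_le_of_exp_abs_le (Z := fun w => inner ℝ (rowVec (A l w) i) h *
      inner ℝ (rowVec (A l w) i) h' - inner ℝ h h')
    (W := fun w => Real.exp (sqRate K) / 2 *
      (Real.exp (sqRate K * inner ℝ (rowVec (A l w) i) h ^ 2) +
        Real.exp (sqRate K * inner ℝ (rowVec (A l w) i) h' ^ 2)))
    (by fun_prop) (hA.integral_inner_mul_inner hK i l h h') (by positivity)
    ((h1.add h2).const_mul _) (fun w => ?_) ?_ ht
  · set u : ℝ := inner ℝ (rowVec (A l w) i) h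
    set v : ℝ := inner ℝ (rowVec (A l w) i) h'
    have hc : |inner ℝ h h'| ≤ 1 := (abs_real_inner_le_norm _ _).trans
      (mul_le_one₀ hh (norm_nonneg _) hh')
    have huv : |u * v - inner ℝ h h'| ≤ u ^ 2 / 2 + v ^ 2 / 2 + 1 := by
      refine (abs_sub _ _).trans (add_le_add ?_ hc)
      rw [abs_le]; constructor <;> nlinarith [sq_nonneg (u + v), sq_nonneg (u - v)]
    calc Real.exp (2 * (sqRate K / 2) * |u * v - inner ℝ h h'|)
        ≤ Real.exp (sqRate K + (sqRate K * u ^ 2 / 2 + sqRate K * v ^ 2 / 2)) := by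
          rw [Real.exp_le_exp]
          have := mul_le_mul_of_nonneg_left huv hθ.le
          linarith
      _ = Real.exp (sqRate K) * (Real.exp (sqRate K * u ^ 2 / 2) *
          Real.exp (sqRate K * v ^ 2 / 2)) := by rw [Real.exp_add, Real.exp_add]
      _ ≤ Real.exp (sqRate K) * ((Real.exp (sqRate K * u ^ 2 / 2) ^ 2 +
          Real.exp (sqRate K * v ^ 2 / 2) ^ 2) / 2) := by
          gcongr
          linarith [sq_nonneg (Real.exp (sqRate K * u ^ 2 / 2) - Real.exp (sqRate K * v ^ 2 / 2))]
      _ = _ := by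
          rw [← Real.exp_nat_mul, ← Real.exp_nat_mul]
          push_cast
          rw [mul_div_cancel₀ _ two_ne_zero, mul_div_cancel₀ _ two_ne_zero]
          ring
  · rw [integral_const_mul, integral_add h1 h2]
    have := mul_le_mul_of_nonneg_left (add_le_add h1' h2')
      (show 0 ≤ Real.exp (sqRate K) / 2 by positivity)
    linarith

theorem tail_le (hA : IsSensingModel P A K) (hK : 0 < K) {h h' : Vec n}
    (hh : ‖h‖ ≤ 1) (hh' : ‖h'‖ ≤ 1) {N ε : ℝ} (hN : 0 ≤ N) (hε : 0 ≤ ε) (hε1 : ε ≤ 1)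
    (c : Fin m × Fin p → ℝ) (hc : ∀ j, N * |c j| ≤ 1) (hc2 : N * ∑ j, c j ^ 2 ≤ 1) :
    P.real {w | ε ≤ |∑ j : Fin m × Fin p, c j * (inner ℝ (rowVec (A j.2 w) j.1) h *
      inner ℝ (rowVec (A j.2 w) j.1) h' - inner ℝ h h')|}
      ≤ 2 * Real.exp (-(tailConst K * N * ε ^ 2)) := by
  have hind : iIndepFun (fun (j : Fin m × Fin p) w => inner ℝ (rowVec (A j.2 w) j.1) h *
      inner ℝ (rowVec (A j.2 w) j.1) h' - inner ℝ h h') P :=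
    hA.indep.comp (fun _ v => inner ℝ v h * inner ℝ v h' - inner ℝ h h') (fun _ => by fun_prop)
  refine measure_le_abs_sum_le (fun j => ?_) hind (half_pos (sqRate_pos hK)) (mgfConst_pos hK)
    (fun j t ht => hA.mgf_le hK j.1 j.2 hh hh' ht) hN hε hε1 c hc hc2
  have := hA.measurable j.1 j.2
  fun_prop

end IsSensingModel

theorem five_pow_le_exp (k : ℕ) : (5 : ℝ) ^ k ≤ Real.exp (2 * k) := by
  rw [mul_comm, Real.exp_nat_mul]
  refine pow_le_pow_left₀ (by norm_num) ?_ k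
  have h1 := Real.exp_one_gt_d9
  rw [show (2 : ℝ) = 1 + 1 by norm_num, Real.exp_add]
  nlinarith

/-- Half of the tail exponent pays for the cardinality of the net, the other half survives. -/
theorem card_mul_exp_neg_le {k : ℕ} {N r s : ℝ} (hN : N ≤ 5 ^ k) (h : 2 * k ≤ s) (hr : s ≤ r / 2) :
    N * (2 * Real.exp (-r)) ≤ 2 * Real.exp (-(r / 2)) := by
  calc N * (2 * Real.exp (-r)) ≤ Real.exp (2 * k) * (2 * Real.exp (-r)) := by
        gcongr
        exact hN.trans (five_pow_le_exp k)
    _ = 2 * Real.exp (2 * k + -r) := by rw [Real.exp_add]; ring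
    _ ≤ _ := by gcongr; linarith

theorem measureReal_biUnion_le_card_mul {Ω ι : Type*} [MeasurableSpace Ω] {P : Measure Ω}
    [IsProbabilityMeasure P] (s : Finset ι) (f : ι → Set Ω) {b : ℝ}
    (h : ∀ i ∈ s, P.real (f i) ≤ b) : P.real (⋃ i ∈ s, f i) ≤ s.card * b := by
  refine (measureReal_biUnion_finset_le s f).trans ((Finset.sum_le_sum h).trans_eq ?_)
  simp

/-- With high probability the sensing matrices satisfy `GoodSensing`. -/
theorem IsSensingModel.exists_goodSensing {Ω : Type*} [MeasurableSpace Ω] {P : Measure Ω}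
    [IsProbabilityMeasure P] {n m p : ℕ} {A : Fin p → Ω → Matrix (Fin m) (Fin n) ℝ} {K : ℝ}
    (hA : IsSensingModel P A K) (hK : 0 < K) (hm : 0 < m) (hp : 0 < p) {xs : Vec n}
    (hxs : xs ≠ 0) {δ : ℝ} (hδ : 0 < δ) (hδ1 : δ < 1)
    (hs : 4 * ((n : ℝ) + m) ≤ tailConst K / 128 * (δ ^ 2 * (√m * p))) :
    ∃ E : Set Ω, MeasurableSet E ∧
      1 - 2 * ((m : ℝ) * Real.exp (-(tailConst K / 128) * δ ^ 2 * p)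
        + Real.exp (-(tailConst K / 128) * δ ^ 2 * √m * p)
        + Real.exp (-(tailConst K / 128) * δ ^ 2 * m * p)) ≤ P.real E ∧
      ∀ w ∈ E, GoodSensing (fun l => A l w) xs (δ / 2) := by
  have hT := tailConst_pos hK
  have hm' : (0 : ℝ) < m := by positivity
  have hp' : (0 : ℝ) < p := by positivity
  have hm1 : (1 : ℝ) ≤ m := by exact_mod_cast hm
  have hsm : 0 < √(m : ℝ) := by positivity
  have hsm1 : 1 ≤ √(m : ℝ) := Real.one_le_sqrt.2 hm1
  have hsq : √(m : ℝ) * √m = m := Real.mul_self_sqrt hm'.le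
  obtain ⟨N, hN, hNc⟩ := exists_isHalfNet (Vec n)
  obtain ⟨N', hN', hNc'⟩ := exists_isHalfNet (Vec m)
  rw [finrank_euclideanSpace_fin] at hNc hNc'
  set u : Vec n := ‖xs‖⁻¹ • xs with hu
  have hu1 : ‖u‖ ≤ 1 := by
    rw [hu, norm_smul, norm_inv, norm_norm, inv_mul_cancel₀ (norm_pos_iff.2 hxs).ne']
  -- Threshold δ/8, since the nets lose a factor 4 and the target is δ/2.
  let bad : Vec n → Vec n → (Fin m × Fin p → ℝ) → Set Ω := fun h h' c =>
    {w | δ / 8 ≤ |∑ j : Fin m × Fin p, c j * (inner ℝ (rowVec (A j.2 w) j.1) h *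
      inner ℝ (rowVec (A j.2 w) j.1) h' - inner ℝ h h')|}
  have hbad : ∀ h h' c, MeasurableSet (bad h h' c) := by
    intro h h' c
    refine measurableSet_le measurable_const (Measurable.abs ?_)
    refine Finset.measurable_fun_sum _ fun j _ => ?_
    have := hA.measurable j.1 j.2
    fun_prop
  let cr : Fin m → Fin m × Fin p → ℝ := fun i j => if j.1 = i then 1 / (p : ℝ) else 0
  let cc : Fin m × Fin p → ℝ := fun _ => 1 / ((m : ℝ) * p)
  let cg : Vec m → Fin m × Fin p → ℝ := fun g j => g j.1 / (√m * p)
  have hε : δ / 8 ≤ 1 := by linarith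
  have hrow : ∀ i ∈ (Finset.univ : Finset (Fin m)), P.real (bad u u (cr i))
      ≤ 2 * Real.exp (-(tailConst K * p * (δ / 8) ^ 2)) := by
    intro i _
    refine hA.tail_le hK hu1 hu1 hp'.le (by positivity) hε _ (fun j => ?_) ?_
    · simp only [cr]
      split_ifs
      · rw [abs_of_pos (by positivity)]; field_simp; rfl
      · simp
    · simp only [cr]
      rw [Fintype.sum_prod_type, Finset.sum_eq_single i (by
        intro b _ hb; simp [hb]) (by simp)]
      simp
      field_simp
      rfl
  have hcov : ∀ q ∈ N ×ˢ N, P.real (bad q.1 q.2 cc)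
      ≤ 2 * Real.exp (-(tailConst K * (m * p) * (δ / 8) ^ 2)) := by
    intro q hq
    obtain ⟨h1, h2⟩ := Finset.mem_product.1 hq
    refine hA.tail_le hK (hN.norm_le _ h1) (hN.norm_le _ h2) (by positivity) (by positivity) hε _
      (fun j => ?_) ?_
    · simp only [cc]
      rw [abs_of_pos (by positivity)]; field_simp; rfl
    · simp [cc]
      field_simp
      rfl
  -- The largest weight limits the effective size to √m p: the sum of squared weights alone would
  -- allow mp.
  have hgain : ∀ q ∈ N ×ˢ N', P.real (bad q.1 u (cg q.2))
      ≤ 2 * Real.exp (-(tailConst K * (√m * p) * (δ / 8) ^ 2)) := by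
    intro q hq
    obtain ⟨h1, h2⟩ := Finset.mem_product.1 hq
    have hg := hN'.norm_le _ h2
    refine hA.tail_le hK (hN.norm_le _ h1) hu1 (by positivity) (by positivity) hε _
      (fun j => ?_) ?_
    · simp only [cg]
      rw [abs_div, abs_of_pos (show 0 < √(m : ℝ) * p by positivity), mul_div_cancel₀ _ (by positivity)]
      exact (PiLp.norm_apply_le q.2 j.1).trans hg
    · have e : ∑ j, cg q.2 j ^ 2 = ‖q.2‖ ^ 2 / (m * p) := by
        simp only [cg, Fintype.sum_prod_type, EuclideanSpace.norm_sq_eq, Real.norm_eq_abs, sq_abs,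
          div_pow, mul_pow, Real.sq_sqrt hm'.le, Finset.sum_const, Finset.card_univ,
          Fintype.card_fin, nsmul_eq_mul, Finset.sum_div]
        refine Finset.sum_congr rfl fun i _ => ?_
        field_simp
      rw [e]
      calc √(m : ℝ) * p * (‖q.2‖ ^ 2 / (m * p)) ≤ √(m : ℝ) * p * (1 / (m * p)) := by
            gcongr; exact pow_le_one₀ (norm_nonneg _) hg
        _ = √(m : ℝ) / m := by field_simp
        _ ≤ 1 := by rw [div_le_one hm']; nlinarith
  let B : Set Ω := ((⋃ i ∈ (Finset.univ : Finset (Fin m)), bad u u (cr i)) ∪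
    ⋃ q ∈ N ×ˢ N', bad q.1 u (cg q.2)) ∪ ⋃ q ∈ N ×ˢ N, bad q.1 q.2 cc
  have hBm : MeasurableSet B :=
    ((Finset.measurableSet_biUnion _ fun _ _ => hbad _ _ _).union
      (Finset.measurableSet_biUnion _ fun _ _ => hbad _ _ _)).union
      (Finset.measurableSet_biUnion _ fun _ _ => hbad _ _ _)
  refine ⟨Bᶜ, hBm.compl, ?_, fun w hw => ?_⟩
  · rw [measureReal_compl hBm, probReal_univ]
    have hsum : P.real B ≤ _ := (measureReal_union_le _ _).trans
      (add_le_add ((measureReal_union_le _ _).trans (add_le_add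
        (measureReal_biUnion_le_card_mul _ _ hrow) (measureReal_biUnion_le_card_mul _ _ hgain)))
        (measureReal_biUnion_le_card_mul _ _ hcov))
    have hc1 : (((N ×ˢ N').card : ℕ) : ℝ) ≤ 5 ^ (n + m) := by
      rw [Finset.card_product, pow_add]
      exact_mod_cast Nat.mul_le_mul hNc hNc'
    have hc2 : (((N ×ˢ N).card : ℕ) : ℝ) ≤ 5 ^ (n + n) := by
      rw [Finset.card_product, pow_add]
      exact_mod_cast Nat.mul_le_mul hNc hNc
    have hn0 : (0 : ℝ) ≤ n := Nat.cast_nonneg n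
    have hb1 := card_mul_exp_neg_le (r := tailConst K * (√m * p) * (δ / 8) ^ 2)
      (s := tailConst K / 128 * (δ ^ 2 * (√m * p))) hc1 (by push_cast; linarith) (by
        apply le_of_eq; ring)
    have hb2 := card_mul_exp_neg_le (r := tailConst K * (m * p) * (δ / 8) ^ 2)
      (s := tailConst K / 128 * (δ ^ 2 * (√m * p))) hc2 (by push_cast; linarith) (by
        have : √(m : ℝ) ≤ m := by nlinarith
        calc tailConst K / 128 * (δ ^ 2 * (√m * p)) ≤ tailConst K / 128 * (δ ^ 2 * (m * p)) := by
              gcongr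
          _ = _ := by ring)
    have hb0 : (m : ℝ) * (2 * Real.exp (-(tailConst K * p * (δ / 8) ^ 2)))
        ≤ m * (2 * Real.exp (-(tailConst K / 128) * δ ^ 2 * p)) := by
      gcongr
      have : 0 ≤ tailConst K * δ ^ 2 * p := by positivity
      linarith
    rw [show -(tailConst K * (√m * p) * (δ / 8) ^ 2 / 2)
      = -(tailConst K / 128) * δ ^ 2 * √m * p by ring] at hb1
    rw [show -(tailConst K * (m * p) * (δ / 8) ^ 2 / 2)
      = -(tailConst K / 128) * δ ^ 2 * m * p by ring] at hb2
    rw [Finset.card_univ, Fintype.card_fin] at hsum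
    linarith
  · simp only [B, Set.mem_compl_iff, Set.mem_union, Set.mem_iUnion, not_or, not_exists] at hw
    obtain ⟨⟨h1, h2⟩, h3⟩ := hw
    rw [show δ / 2 = 4 * (δ / 8) by ring]
    refine GoodSensing.of_nets hxs hp hm hN hN' hu (fun i => ?_) (fun h hh h' hh' => ?_)
      (fun h hh g hg => ?_)
    · exact (not_le.1 (h1 i (Finset.mem_univ i))).le
    · exact (not_le.1 (h3 (h, h') (Finset.mk_mem_product hh hh'))).le
    · exact (not_le.1 (h2 (h, g) (Finset.mk_mem_product hh hg))).le

/-! ### Constants and conclusion -/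

theorem half_le_log_div {n : ℕ} (hn : 0 < n) {δ : ℝ} (hδ : 0 < δ) (hδ2 : δ ≤ 1 / 2) :
    1 / 2 ≤ Real.log (n / δ) := by
  have hn1 : (1 : ℝ) ≤ n := by exact_mod_cast hn
  have h2 : (2 : ℝ) ≤ n / δ := by rw [le_div_iff₀ hδ]; linarith
  have := Real.log_le_log two_pos h2
  linarith [Real.log_two_gt_d9]

end BlindCal

end

open BlindCal in
theorem theorem1 :
    ∀ K : ℝ, 0 < K →
    -- `C₀` is the implicit constant of the sample complexity conditions
    ∃ C c C₀ : ℝ, 0 < C ∧ 0 < c ∧ 0 < C₀ ∧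
    ∀ (Ω : Type*) [MeasurableSpace Ω] (P : Measure Ω) [IsProbabilityMeasure P]
      (n m p : ℕ) (A : Fin p → Ω → Matrix (Fin m) (Fin n) ℝ)
      (x : Vec n) (d : Vec m) (δ ρ t : ℝ),
    0 < m → 0 < p →
    IsSensingModel P A K →
    x ≠ 0 → (∀ i, 0 < d i) →
    0 ≤ ρ → dStar d ∈ gainSet m ρ →
    0 < δ → δ < 1 → 1 ≤ t →
    ρ < (1 - 2 * δ) / 9 →
    C₀ * (t * Real.log ((m : ℝ) * p)) ≤ (n : ℝ) →
    C₀ * (δ⁻¹ ^ 2 * Real.log (m : ℝ)) ≤ (p : ℝ) →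
    C₀ * (δ⁻¹ ^ 2 * ((n : ℝ) + m) * Real.log (n / δ)) ≤ Real.sqrt m * p →
    -- `(x⋆, d⋆)` is a global minimiser
    (dStar d ∈ simplex m ∧ ∀ w, ∀ ξ : Vec n, ∀ γ ∈ simplex m,
      objective (fun l => A l w) (snapshots (fun l => A l w) x d) (xStar x d) (dStar d)
        ≤ objective (fun l => A l w) (snapshots (fun l => A l w) x d) ξ γ) ∧
    ∃ E : Set Ω, MeasurableSet E ∧
      1 - C * ((m : ℝ) * Real.exp (-c * δ ^ 2 * p) + Real.exp (-c * δ ^ 2 * Real.sqrt m * p)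
        + Real.exp (-c * δ ^ 2 * m * p) + ((m : ℝ) * p) ^ (-t)) < P.real E ∧
      ∀ w ∈ E, ∀ μ : ℝ, 0 < μ →
        μ < tau m (xStar x d) * eta δ ρ / lipL (xStar x d) δ ρ ^ 2 →
        let z := pgd (fun l => A l w) (snapshots (fun l => A l w) x d) ρ
          μ (μ * ((m : ℝ) / ‖xStar x d‖ ^ 2))
        let r := 1 - eta δ ρ * μ + lipL (xStar x d) δ ρ ^ 2 / tau m (xStar x d) * μ ^ 2
        (∀ k, z k ∈ nbhdD (xStar x d) (dStar d) (kappa δ ρ) ρ) ∧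
        (∀ k, dist2 (xStar x d) (dStar d) (z k).1 (z k).2
          ≤ r ^ k * ((δ ^ 2 + ρ ^ 2) * ‖xStar x d‖ ^ 2)) ∧
        0 < r ∧ r < 1 ∧
        Tendsto (fun k => dist2 (xStar x d) (dStar d) (z k).1 (z k).2) atTop (𝓝 0) ∧
        Tendsto z atTop (𝓝 (xStar x d, dStar d)) := by
  intro K hK
  have hT := tailConst_pos hK
  -- 128 = 2 · 8²: threshold δ/8 squared and half the exponent spent on nets. 1024 = 4 · 128 · 2:
  -- the 4(n + m) that dominates both net entropies, and the lower bound 1/2 on the logarithm.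
  refine ⟨2, tailConst K / 128, 1024 / tailConst K, two_pos, by positivity, by positivity, ?_⟩
  intro Ω _ P _ n m p A x d δ ρ t hm hp hA hx hd hρ0 hds hδ hδ1 _ hρ _ _ hs
  refine ⟨⟨dStar_mem_simplex hm hd, fun w ξ γ _ => objective_star_le hm hd _ x ξ γ⟩, ?_⟩
  have hn : 0 < n := by
    rcases Nat.eq_zero_or_pos n with rfl | h
    · exact absurd (Subsingleton.elim x 0) hx
    · exact h
  have hxs : xStar x d ≠ 0 :=
    smul_ne_zero (div_pos (l1Norm_pos hm hd) (by positivity)).ne' hx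
  have hs' : 4 * ((n : ℝ) + m) ≤ tailConst K / 128 * (δ ^ 2 * (√m * p)) := by
    have hlog := half_le_log_div hn hδ (by linarith)
    calc 4 * ((n : ℝ) + m) = tailConst K / 128 * (δ ^ 2 *
          (1024 / tailConst K * (δ⁻¹ ^ 2 * ((n : ℝ) + m) * (1 / 2)))) := by
          field_simp; norm_num
      _ ≤ tailConst K / 128 * (δ ^ 2 *
          (1024 / tailConst K * (δ⁻¹ ^ 2 * ((n : ℝ) + m) * Real.log (n / δ)))) := by gcongr
      _ ≤ _ := by gcongr
  obtain ⟨E, hE, hPE, hgood⟩ := hA.exists_goodSensing hK hm hp hxs hδ hδ1 hs'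
  refine ⟨E, hE, lt_of_lt_of_le ?_ hPE, fun w hw μ hμ hμ2 => ?_⟩
  -- Positivity of this term makes the probability bound strict.
  · have : 0 < ((m : ℝ) * p) ^ (-t) := by positivity
    linarith
  · exact (hgood w hw).pgd_converges hm hxs hδ.le hρ0 hρ
      (fun l i => snapshots_apply hm hd _ x l i) hds hμ hμ2
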